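/- **Lemma (Expected typical degree).** Let $d\ge 1$, $a\ge 0$, $\alpha>1$, $\beta>a\alpha$. Let $\varphi\colon[0,\infty)\to[0,1]$ be measurable with $\int_0^\infty\varphi(r)\,\mathrm dr=1$ and regularly varying at infinity with tail index $\alpha$ (i.e. eventually positive with $\varphi(tr)/\varphi(r)\to t^{-\alpha}$ as $r\to\infty$ for every $t>0$). Let $W$ be a random variable with values in $(0,\infty)$ and distribution function $F$ such that $1-F$ is regularly varying at infinity with tail index $\beta$. Put $\kappa(w_1,w_2)=(w_1\wedge w_2)(w_1\vee w_2)^a$ and $$h(w)=w\,\mathbb E\big[\mathbf 1\{W\ge w\}W^a\big]+w^a\,\mathbb E\big[\mathbf 1\{W<w\}W\big].$$ For $s>0$ and $v>0$ let $G(\mathcal P_s,v)$ be the following random graph. Its vertex set is a homogeneous Poisson point process $\mathcal P_s$ on $\mathbb R^d$ with intensity $s$; the vertices $x\in\mathcal P_s$ carry independent weights $W_x$, distributed as $W$ and independent of $\mathcal P_s$; given the vertices and weights, distinct vertices $x,y$ are joined by an edge, independently over unordered pairs, with probability $$\varphi\big(|B_{|x-y|}(o)|/(v\,\kappa(W_x,W_y))\big),$$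 where $|B_r(o)|$ is the volume of the Euclidean ball of radius $r$ centered at the origin $o$ of $\mathbb R^d$. Let $k\ge 0$ be an integer and let $s>0$ be such that the equation $$k!=s\,\mathbb E\big[(s v\,h(W))^k\exp(-s v\,h(W))\big]$$ has a largest solution $v=v_{s,k}$ in $(0,\infty)$. Let $D_{s,k}$ be the number of vertices of $G(\mathcal P_s,v_{s,k})$ that lie in $[0,1]^d$ and have degree $k$, where the degree of a vertex counts all its neighbors, including those outside $[0,1]^d$. Then $D_{s,k}$ is a random variable (with values in $\{0,1,2,\dots\}\cup\{\infty\}$) and $$\mathbb E[D_{s,k}]=1 .$$ -/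

import Mathlib

open MeasureTheory ProbabilityTheory Filter Topology

namespace WRCM

/-- `f` is regularly varying at infinity with tail index `ρ` (that is, with index `-ρ`):
it is eventually positive and `f (t x) / f x → t ^ (-ρ)` as `x → ∞`, for every `t > 0`. -/
def RegularlyVaryingTail (f : ℝ → ℝ) (ρ : ℝ) : Prop :=
  (∀ᶠ x in atTop, 0 < f x) ∧
    ∀ t : ℝ, 0 < t → Tendsto (fun x => f (t * x) / f x) atTop (𝓝 (t ^ (-ρ)))

/-- The preferential-attachment kernel `κ(w₁, w₂) = (w₁ ∧ w₂) (w₁ ∨ w₂)^a`. -/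
noncomputable def kernel (a w₁ w₂ : ℝ) : ℝ := min w₁ w₂ * max w₁ w₂ ^ a

/-- The connection probability
`p(x, w; y, w') = φ (|B_{|x - y|}(o)| / (v κ(w, w')))`, where `|B_r(o)|` is the volume of the
centered Euclidean ball of radius `r`. -/
noncomputable def connProb (d : ℕ) (a : ℝ) (φ : ℝ → ℝ) (v : ℝ)
    (x : EuclideanSpace ℝ (Fin d)) (w : ℝ) (y : EuclideanSpace ℝ (Fin d)) (w' : ℝ) : ℝ :=
  φ (volume.real (Metric.ball (0 : EuclideanSpace ℝ (Fin d)) (dist x y)) / (v * kernel a w w'))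

theorem connProb_comm (d : ℕ) (a : ℝ) (φ : ℝ → ℝ) (v : ℝ)
    (x : EuclideanSpace ℝ (Fin d)) (w : ℝ) (y : EuclideanSpace ℝ (Fin d)) (w' : ℝ) :
    connProb d a φ v x w y w' = connProb d a φ v y w' x w := by
  simp only [connProb, kernel, dist_comm x y, min_comm w w', max_comm w w']

/-- `h(w) = w 𝔼[𝟙{W ≥ w} W^a] + w^a 𝔼[𝟙{W < w} W]`, where `W` has law `ν`. -/
noncomputable def h (a : ℝ) (ν : Measure ℝ) (w : ℝ) : ℝ :=
  w * (∫ u in Set.Ici w, u ^ a ∂ν) + w ^ a * (∫ u in Set.Iio w, u ∂ν)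

/-- The positive solutions `v` of the scaling equation
`k! = s 𝔼[(s v h(W))^k exp(-s v h(W))]`, where `W` has law `ν`. -/
def scalingSolutions (a : ℝ) (ν : Measure ℝ) (s : ℝ) (k : ℕ) : Set ℝ :=
  {v | 0 < v ∧ (k.factorial : ℝ) =
    s * ∫ w, (s * v * h a ν w) ^ k * Real.exp (-(s * v * h a ν w)) ∂ν}

/-- `v = v_{s,k}`: the largest positive solution of the scaling equation. -/
def IsScaling (a : ℝ) (ν : Measure ℝ) (s : ℝ) (k : ℕ) (v : ℝ) : Prop :=
  IsGreatest (scalingSolutions a ν s k) v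

section Model

variable {Ω : Type*} {d : ℕ}

/-- The number of points of the point configuration `(X n ω)_n` in `B`. -/
noncomputable def count (X : ℕ → Ω → EuclideanSpace ℝ (Fin d))
    (B : Set (EuclideanSpace ℝ (Fin d))) (ω : Ω) : ℕ∞ :=
  {n | X n ω ∈ B}.encard

/-- The random points `X 0, X 1, …` enumerate a homogeneous Poisson point process on `ℝ^d` with
intensity `s`: the number of points in a Borel set `B` of finite volume is Poisson with mean
`s |B|`, and the numbers of points in disjoint Borel sets are independent. (For `s > 0` and
`d ≥ 1` such a process has almost surely infinitely many points, pairwise distinct,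
so that it is enumerated by `ℕ`.) -/
structure IsHomogeneousPPP [MeasurableSpace Ω] (P : Measure Ω) (s : ℝ)
    (X : ℕ → Ω → EuclideanSpace ℝ (Fin d)) : Prop where
  measurable : ∀ n, Measurable (X n)
  count_law : ∀ B : Set (EuclideanSpace ℝ (Fin d)), MeasurableSet B → volume B < ⊤ →
    ∀ n : ℕ, P {ω | count X B ω = n} = poissonMeasure (s * volume.real B).toNNReal {n}
  count_indep : ∀ (m : ℕ) (B : Fin m → Set (EuclideanSpace ℝ (Fin d))),
    (∀ i, MeasurableSet (B i)) → Pairwise (fun i j => Disjoint (B i) (B j)) →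
    iIndepFun (fun i => count X (B i)) P

/-- The random input of the weighted random connection model: a homogeneous Poisson point process
`X` of intensity `s`; independent weights `W` of law `ν`, one for each point; and independent
uniform variables `U`, one for each unordered pair of points; `X`, `W`, `U` are independent. -/
structure IsModelInput [MeasurableSpace Ω] (P : Measure Ω) (s : ℝ) (ν : Measure ℝ)
    (X : ℕ → Ω → EuclideanSpace ℝ (Fin d)) (W : ℕ → Ω → ℝ) (U : Sym2 ℕ → Ω → ℝ) : Prop where
  ppp : IsHomogeneousPPP P s X
  weight_measurable : ∀ n, Measurable (W n)
  weight_law : ∀ n, P.map (W n) = ν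
  weight_indep : iIndepFun W P
  unif_measurable : ∀ e, Measurable (U e)
  unif_law : ∀ e, P.map (U e) = volume.restrict (Set.Icc (0 : ℝ) 1)
  unif_indep : iIndepFun U P
  indep_points_weights : IndepFun (fun ω n => X n ω) (fun ω n => W n ω) P
  indep_points_weights_unif :
    IndepFun (fun ω => ((fun n => X n ω), (fun n => W n ω))) (fun ω e => U e ω) P

/-- The random graph `G(𝒫_s, v)` (the vertex `i` stands for the point `X i ω`): given points and
weights, distinct vertices `i`, `j` are joined, independently over pairs, with probability
`p(X i, W i; X j, W j)`. -/
def graph (a : ℝ) (φ : ℝ → ℝ) (v : ℝ) (X : ℕ → Ω → EuclideanSpace ℝ (Fin d))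
    (W : ℕ → Ω → ℝ) (U : Sym2 ℕ → Ω → ℝ) (ω : Ω) : SimpleGraph ℕ where
  Adj i j := i ≠ j ∧ U s(i, j) ω < connProb d a φ v (X i ω) (W i ω) (X j ω) (W j ω)
  symm := ⟨fun i j hij => by
    refine ⟨hij.1.symm, ?_⟩
    rw [Sym2.eq_swap, connProb_comm]
    exact hij.2⟩
  loopless := ⟨fun _ hi => hi.1 rfl⟩

/-- `D_{s,k}`: the number of points in `[0,1]^d` whose degree in the graph (counting neighbors
anywhere in `ℝ^d`) is equal to `k`. -/
noncomputable def degreeCount (a : ℝ) (φ : ℝ → ℝ) (v : ℝ) (k : ℕ)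
    (X : ℕ → Ω → EuclideanSpace ℝ (Fin d)) (W : ℕ → Ω → ℝ) (U : Sym2 ℕ → Ω → ℝ) (ω : Ω) : ℕ∞ :=
  {i | (∀ l, X i ω l ∈ Set.Icc (0 : ℝ) 1) ∧
    ((graph a φ v X W U ω).neighborSet i).encard = k}.encard

end Model

end WRCM

/-! Let Λ(z) be the mean degree of a vertex with position and weight z. Heuristically, its neighbors
form an independent thinning of a Poisson process, so its degree is Poisson with mean Λ(z). Mecke's
formula then gives the expected count as the integral of P(Poisson(Λ) = k) over cube times weights.
Since Λ = s v h(w), this is the scaling equation divided by k!.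

The Poisson process is given here only through its counts, and factorial moments take the place of
Mecke's formula. Independent Poisson counts of disjoint sets determine the factorial moment
measures: the laws of the points, summed over injective m-tuples of indices, add up to the m-th
power of the intensity (`sum_map_embedding_eq_pi`), also with weights attached
(`sum_map_marked_eq_pi`). A vertex with an injective m-tuple of neighbors is a star with m distinct
edges, so the degrees have the integrals of Λ^m as factorial moments (`lintegral_descFact_degree`),
exactly as a mixture of Poisson laws would. An alternating sum recovers the masses from the moments
if these grow at most geometrically (`eq_of_factorial_moments`). This settles sets of finite
intensity on which Λ is bounded; exhaustion gives the rest (`lintegral_degree_eq`).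

To compute Λ, the ball volume |B_{|x-y|}| is used as variable of integration: ∫φ = 1 yields s v κ(w,
u) for neighbors of weight u, and averaging over u yields s v h(w) (`meanDegree_eq`). This is finite
because a ≤ aα < β makes E[W^a] finite. -/

namespace WRCM

/-! ### Counting injective tuples of indices -/

/-- The number of injective maps from a type with `m` elements to a set with `x` elements. -/
noncomputable def descFact (x : ℕ∞) (m : ℕ) : ENNReal :=
  if x = ⊤ then (if m = 0 then 1 else ⊤) else (x.toNat.descFactorial m : ENNReal)

theorem descFact_natCast (n m : ℕ) : descFact n m = (n.descFactorial m : ENNReal) := by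
  simp [descFact]

theorem descFact_top {m : ℕ} (hm : m ≠ 0) : descFact ⊤ m = ⊤ := by
  simp [descFact, hm]

@[simp] theorem descFact_zero (x : ℕ∞) : descFact x 0 = 1 := by
  simp [descFact]

instance countable_embedding {ι : Type*} [Finite ι] : Countable (ι ↪ ℕ) :=
  DFunLike.coe_injective.countable

theorem infinite_embedding {ι κ : Type*} [Fintype ι] [Nonempty ι] [Infinite κ] :
    Infinite (ι ↪ κ) := by
  classical
  obtain ⟨i₀⟩ := ‹Nonempty ι›
  let f : ι ↪ κ := ((Fintype.equivFin ι).toEmbedding.trans Fin.valEmbedding).trans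
    (Infinite.natEmbedding κ)
  refine Infinite.of_surjective (fun g : ι ↪ κ => g i₀) fun s => ?_
  -- Swapping `f i₀` with `s` makes evaluation at `i₀` surjective onto an infinite type.
  exact ⟨f.trans (Equiv.swap (f i₀) s).toEmbedding, by simp⟩

theorem card_embedding_set {ι : Type*} [Fintype ι] (S : Set ℕ) :
    ((ENat.card (ι ↪ S) : ℕ∞) : ENNReal) = descFact S.encard (Fintype.card ι) := by
  classical
  by_cases hS : S.Finite
  · have : Fintype S := hS.fintype
    rw [ENat.card_eq_coe_fintype_card, Fintype.card_embedding_eq, ← Set.coe_fintypeCard,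
      descFact_natCast]
    simp
  · have : Infinite S := Set.infinite_coe_iff.mpr hS
    rw [Set.Infinite.encard_eq hS]
    rcases isEmpty_or_nonempty ι with h | h
    · simp
    · have := infinite_embedding (ι := ι) (κ := S)
      simp [descFact_top (Fintype.card_ne_zero (α := ι))]

/-- Embeddings sending `l` into `S (σ l)`, for disjoint sets `S c`, split over the fibers of `σ`. -/
noncomputable def embeddingFiberEquiv {ι κ : Type*} (S : κ → Set ℕ)
    (hS : Pairwise fun c c' => Disjoint (S c) (S c')) (σ : ι → κ) :
    {t : ι ↪ ℕ // ∀ l, t l ∈ S (σ l)} ≃ (∀ c, {l // σ l = c} ↪ S c) where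
  toFun t c := ⟨fun l => ⟨t.1 l.1, by have := t.2 l.1; rwa [l.2] at this⟩, fun l l' hl => by
    ext
    exact t.1.injective (congrArg Subtype.val hl)⟩
  invFun g := ⟨⟨fun l => (g (σ l) ⟨l, rfl⟩ : ℕ), fun l l' hl => by
    have key : ∀ c c' (x : {l // σ l = c}) (y : {l // σ l = c'}),
        ((g c x : S c) : ℕ) = (g c' y : S c') → x.1 = y.1 := by
      intro c c' x y hxy
      by_cases hc : c = c'
      · subst hc
        exact congrArg Subtype.val ((g c).injective (Subtype.ext hxy))
      · exact absurd (hxy ▸ (g c' y).2 : ((g c x : S c) : ℕ) ∈ S c')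
          (Set.disjoint_left.mp (hS hc) (g c x).2)
    exact key _ _ _ _ hl⟩, fun l => (g (σ l) ⟨l, rfl⟩).2⟩
  left_inv t := by ext; rfl
  right_inv g := by
    funext c
    ext ⟨l, hl⟩
    subst hl
    rfl

theorem ENatCard_pi {κ : Type*} [Fintype κ] (F : κ → Type*) :
    ((ENat.card (∀ c, F c) : ℕ∞) : ENNReal) = ∏ c, ((ENat.card (F c) : ℕ∞) : ENNReal) := by
  classical
  by_cases h0 : ∃ c, IsEmpty (F c)
  · obtain ⟨c, hc⟩ := h0
    have : IsEmpty (∀ c, F c) := ⟨fun f => hc.false (f c)⟩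
    rw [Finset.prod_eq_zero (Finset.mem_univ c) (by simp [(ENat.card_eq_zero_iff_empty _).mpr hc])]
    simp [(ENat.card_eq_zero_iff_empty _).mpr this]
  simp only [not_exists, not_isEmpty_iff] at h0
  by_cases hf : ∀ c, Finite (F c)
  · simp only [ENat.card_eq_coe_natCard, ENat.toENNReal_coe]
    rw [Nat.card_pi, Nat.cast_prod]
  · simp only [not_forall, not_finite_iff_infinite] at hf
    obtain ⟨c, hc⟩ := hf
    have : Infinite (∀ c, F c) := Pi.infinite_of_exists_right c
    rw [← Finset.mul_prod_erase _ _ (Finset.mem_univ c), ENat.card_eq_top_of_infinite,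
      ENat.card_eq_top_of_infinite, ENat.toENNReal_top, ENNReal.top_mul]
    refine Finset.prod_ne_zero_iff.mpr fun c' _ => ?_
    have := h0 c'
    simp

/-- Each summand is 0 or 1, so the sum counts embeddings. Disjointness of the sets makes injectivity
a separate condition on each fiber of `σ`, hence the count factorizes. -/
theorem tsum_embedding_prod_indicator {ι κ : Type*} [Fintype ι] [Fintype κ] [DecidableEq κ]
    (S : κ → Set ℕ) (hS : Pairwise fun c c' => Disjoint (S c) (S c')) (σ : ι → κ) :
    ∑' t : ι ↪ ℕ, ∏ l, (S (σ l)).indicator (fun _ => (1 : ENNReal)) (t l) =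
      ∏ c, descFact (S c).encard (Fintype.card {l // σ l = c}) := by
  classical
  have h1 : ∀ t : ι ↪ ℕ, ∏ l, (S (σ l)).indicator (fun _ => (1 : ENNReal)) (t l) =
      Set.indicator {t : ι ↪ ℕ | ∀ l, t l ∈ S (σ l)} (fun _ => (1 : ENNReal)) t := by
    intro t
    by_cases ht : ∀ l, t l ∈ S (σ l)
    · rw [Set.indicator_of_mem (show t ∈ {t : ι ↪ ℕ | ∀ l, t l ∈ S (σ l)} from ht)]
      exact Finset.prod_eq_one fun l _ => Set.indicator_of_mem (ht l) _
    · rw [Set.indicator_of_notMem (show t ∉ {t : ι ↪ ℕ | ∀ l, t l ∈ S (σ l)} from ht)]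
      push Not at ht
      obtain ⟨l, hl⟩ := ht
      exact Finset.prod_eq_zero (Finset.mem_univ l) (Set.indicator_of_notMem hl _)
  simp_rw [h1]
  rw [← tsum_subtype]
  have h2 : ∑' _ : {t : ι ↪ ℕ // ∀ l, t l ∈ S (σ l)}, (1 : ENNReal) =
      (ENat.card {t : ι ↪ ℕ // ∀ l, t l ∈ S (σ l)} : ℕ∞) := by
    simp
  refine h2.trans ?_
  rw [ENat.card_congr (embeddingFiberEquiv S hS σ), ENatCard_pi]
  exact Finset.prod_congr rfl fun c _ => card_embedding_set _

theorem tsum_embedding_indicator (m : ℕ) (S : Set ℕ) :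
    ∑' t : Fin m ↪ ℕ, ∏ l, S.indicator (fun _ => (1 : ENNReal)) (t l) = descFact S.encard m := by
  have h := tsum_embedding_prod_indicator (ι := Fin m) (κ := Unit) (fun _ => S)
    (fun c c' h => absurd (Subsingleton.elim c c') h) (fun _ => ())
  simpa using h

/-! ### Factorial moments of Poisson counts -/

theorem poissonMeasure_mul_descFact (r : NNReal) (m n : ℕ) :
    poissonMeasure r {n + m} * descFact ((n + m : ℕ) : ℕ∞) m =
      (r : ENNReal) ^ m * poissonMeasure r {n} := by
  have h2 : (((n + m).factorial : ℕ) : ℝ) = n.factorial * ((n + m).descFactorial m : ℕ) := by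
    rw [← Nat.factorial_mul_descFactorial (Nat.le_add_left m n)]
    simp
  have h3 : (((n + m).descFactorial m : ℕ) : ℝ) ≠ 0 := by
    rw [Nat.cast_ne_zero, Ne, Nat.descFactorial_eq_zero_iff_lt]
    omega
  have h4 : (n.factorial : ℝ) ≠ 0 := by positivity
  rw [poissonMeasure_singleton, poissonMeasure_singleton, descFact_natCast,
    ← ENNReal.ofReal_natCast, ← ENNReal.ofReal_mul (by positivity),
    ← ENNReal.ofReal_coe_nnreal, ← ENNReal.ofReal_pow (by positivity),
    ← ENNReal.ofReal_mul (by positivity)]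
  congr 1
  rw [h2]
  generalize (((n + m).descFactorial m : ℕ) : ℝ) = x at *
  field_simp
  ring

theorem tsum_poisson_descFact (r : NNReal) (m : ℕ) :
    ∑' n : ℕ, poissonMeasure r {n} * descFact n m = (r : ENNReal) ^ m := by
  have h0 : ∀ n ∈ Finset.range m, poissonMeasure r {n} * descFact (n : ℕ∞) m = 0 := by
    intro n hn
    rw [descFact_natCast, Nat.descFactorial_eq_zero_iff_lt.mpr (Finset.mem_range.mp hn)]
    simp
  have h1 : ∀ f : ℕ → ENNReal, ∑ n ∈ Finset.range m, f n + ∑' n, f (n + m) = ∑' n, f n :=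
    fun f => Summable.sum_add_tsum_nat_add' (f := f) (k := m) ENNReal.summable
  rw [← h1, Finset.sum_eq_zero h0, zero_add]
  simp only [poissonMeasure_mul_descFact]
  have h5 := Measure.tsum_indicator_apply_singleton (poissonMeasure r) Set.univ MeasurableSet.univ
  rw [Set.indicator_univ, measure_univ] at h5
  rw [ENNReal.tsum_mul_left, h5, mul_one]

/-- The law of an `ℕ∞`-valued random variable is determined by its finite masses when they sum
up to one. -/
theorem lintegral_of_law {Ω : Type*} [MeasurableSpace Ω] {P : Measure Ω} [IsProbabilityMeasure P]
    {N : Ω → ℕ∞} (hN : Measurable N) (q : Measure ℕ) [IsProbabilityMeasure q]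
    (h : ∀ n : ℕ, P {ω | N ω = n} = q {n}) (f : ℕ∞ → ENNReal) :
    ∫⁻ ω, f (N ω) ∂P = ∑' n : ℕ, q {n} * f n := by
  have hmap : P.map N = q.map (fun n : ℕ => (n : ℕ∞)) := by
    have hfin : ∀ n : ℕ, P.map N {(n : ℕ∞)} = q {n} := fun n => by
      rw [Measure.map_apply hN (by measurability), ← h n]; rfl
    have hfin' : ∀ n : ℕ, q.map (fun n : ℕ => (n : ℕ∞)) {(n : ℕ∞)} = q {n} := fun n => by
      rw [Measure.map_apply (by fun_prop) (by measurability)]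
      congr 1
      ext x
      simp
    have : IsProbabilityMeasure (P.map N) := Measure.isProbabilityMeasure_map hN.aemeasurable
    have : IsProbabilityMeasure (q.map (fun n : ℕ => (n : ℕ∞))) :=
      Measure.isProbabilityMeasure_map (by fun_prop)
    -- Only an inequality is immediate, as the mass of `N` at `⊤` is not known to vanish. Two
    -- ordered probability measures coincide, which forces it to be zero.
    have hle : q.map (fun n : ℕ => (n : ℕ∞)) ≤ P.map N := by
      refine Measure.le_iff.mpr fun s _ => ?_
      rw [← Measure.tsum_indicator_apply_singleton _ s (by measurability),
        ← Measure.tsum_indicator_apply_singleton (P.map N) s (by measurability)]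
      refine ENNReal.tsum_le_tsum fun x => ?_
      by_cases hx : x ∈ s
      · simp only [Set.indicator_of_mem hx]
        induction x with
        | top =>
          rw [Measure.map_apply (by fun_prop) (by measurability)]
          have : (fun n : ℕ => (n : ℕ∞)) ⁻¹' {⊤} = ∅ := by ext; simp
          simp [this]
        | coe n => rw [hfin, hfin']
      · simp [hx]
    exact (Measure.eq_of_le_of_isProbabilityMeasure hle).symm
  have h1 : ∫⁻ ω, f (N ω) ∂P = ∫⁻ x, f x ∂(P.map N) :=
    (lintegral_map (by fun_prop) hN).symm
  rw [h1, hmap, lintegral_map (by fun_prop) (by fun_prop), lintegral_countable']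
  exact tsum_congr fun n => mul_comm _ _

section

variable {Ω : Type*} [MeasurableSpace Ω] {P : Measure Ω} [IsProbabilityMeasure P] {d : ℕ} {s : ℝ}
  {X : ℕ → Ω → EuclideanSpace ℝ (Fin d)}

theorem measurable_count (hX : ∀ n, Measurable (X n)) {B : Set (EuclideanSpace ℝ (Fin d))}
    (hB : MeasurableSet B) : Measurable (count X B) := by
  refine measurable_encard.comp ?_
  rw [measurable_set_iff]
  intro n
  exact (measurableSet_setOfPred (p := fun ω => X n ω ∈ B)).mp (hX n hB)

theorem measurable_descFact_count (hX : ∀ n, Measurable (X n))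
    {B : Set (EuclideanSpace ℝ (Fin d))} (hB : MeasurableSet B) (m : ℕ) :
    Measurable fun ω => descFact (count X B ω) m :=
  (Measurable.of_discrete (f := fun x => descFact x m)).comp (measurable_count hX hB)

theorem lintegral_descFact_count (hX : IsHomogeneousPPP P s X)
    {B : Set (EuclideanSpace ℝ (Fin d))} (hB : MeasurableSet B) (hB' : volume B < ⊤) (m : ℕ) :
    ∫⁻ ω, descFact (count X B ω) m ∂P = (ENNReal.ofReal s * volume B) ^ m := by
  rw [lintegral_of_law (measurable_count hX.measurable hB) _ (hX.count_law B hB hB')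
    (fun x => descFact x m), tsum_poisson_descFact]
  congr 1
  rw [Measure.real, ← ENNReal.ofReal, ENNReal.ofReal_mul' ENNReal.toReal_nonneg,
    ENNReal.ofReal_toReal hB'.ne]

end

/-! ### Factorial moment measures of the Poisson process -/

section Atoms

variable {ι E : Type*}

/-- The atoms of the algebra generated by the sets `A l`, within their union. -/
def atom (A : ι → Set E) (T : Finset ι) : Set E :=
  {x | (∃ l, x ∈ A l) ∧ ∀ l, x ∈ A l ↔ l ∈ T}

theorem disjoint_atom (A : ι → Set E) : Pairwise fun T T' => Disjoint (atom A T) (atom A T') := by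
  intro T T' hT
  refine Set.disjoint_left.mpr fun x hx hx' => hT ?_
  ext l
  rw [← hx.2, hx'.2]

theorem measurableSet_atom [Fintype ι] [DecidableEq ι] [MeasurableSpace E] {A : ι → Set E} (hA : ∀ l, MeasurableSet (A l))
    (T : Finset ι) : MeasurableSet (atom A T) := by
  have : atom A T = (⋃ l, A l) ∩ ⋂ l, if l ∈ T then A l else (A l)ᶜ := by
    ext x
    simp only [atom, Set.mem_ofPred_eq, Set.mem_inter_iff, Set.mem_iUnion, Set.mem_iInter]
    refine and_congr_right fun _ => forall_congr' fun l => ?_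
    by_cases hl : l ∈ T <;> simp [hl]
  rw [this]
  refine (MeasurableSet.iUnion hA).inter (MeasurableSet.iInter fun l => ?_)
  split_ifs
  exacts [hA l, (hA l).compl]

theorem indicator_eq_sum_atom [Fintype ι] [DecidableEq ι] (A : ι → Set E) (l : ι) (x : E) :
    (A l).indicator (fun _ => (1 : ENNReal)) x =
      ∑ T : Finset ι, (if l ∈ T then 1 else 0) * (atom A T).indicator (fun _ => 1) x := by
  classical
  by_cases hx : x ∈ A l
  · rw [Finset.sum_eq_single (Finset.univ.filter fun l => x ∈ A l)]
    · have h1 : x ∈ atom A (Finset.univ.filter fun l => x ∈ A l) := ⟨⟨l, hx⟩, by simp⟩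
      simp [h1, hx]
    · intro T _ hT
      have h1 : x ∉ atom A T := fun h => hT (by ext l; simp [h.2])
      simp [h1]
    · simp
  · rw [Set.indicator_of_notMem hx, Finset.sum_eq_zero]
    intro T _
    by_cases hT : x ∈ atom A T
    · simp [← hT.2, hx]
    · simp [hT]

end Atoms

section

variable {Ω : Type*} [MeasurableSpace Ω] {P : Measure Ω} [IsProbabilityMeasure P] {d : ℕ} {s : ℝ}
  {X : ℕ → Ω → EuclideanSpace ℝ (Fin d)}

theorem lintegral_prod_descFact_count (hX : IsHomogeneousPPP P s X) {κ : Type*} [Fintype κ]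
    (C : κ → Set (EuclideanSpace ℝ (Fin d))) (hC : ∀ c, MeasurableSet (C c))
    (hC' : ∀ c, volume (C c) < ⊤) (hd : Pairwise fun c c' => Disjoint (C c) (C c'))
    (m : κ → ℕ) :
    ∫⁻ ω, ∏ c, descFact (count X (C c) ω) (m c) ∂P =
      ∏ c, (ENNReal.ofReal s * volume (C c)) ^ m c := by
  have hind : iIndepFun (fun c => count X (C c)) P := by
    have h := hX.count_indep (Fintype.card κ) (fun i => C ((Fintype.equivFin κ).symm i))
      (fun i => hC _) (fun i j hij => hd (by simpa using hij))
    simpa using h.precomp (Fintype.equivFin κ).injective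
  have hind' : iIndepFun (fun c ω => descFact (count X (C c) ω) (m c)) P :=
    hind.comp (fun c x => descFact x (m c)) fun c => by fun_prop
  rw [lintegral_prod_eq_prod_lintegral_of_indepFun Finset.univ _ hind' fun c =>
    measurable_descFact_count hX.measurable (hC c) _]
  exact Finset.prod_congr rfl fun c _ => lintegral_descFact_count hX (hC c) (hC' c) _

/-- The sets `A l` may overlap, while independence concerns disjoint sets only. Each `A l` is
therefore cut into atoms; both sides are multilinear in the indicators, and for atoms the sum over
embeddings is a product of falling factorials of independent counts. -/
theorem tsum_embedding_rectangle (hX : IsHomogeneousPPP P s X) {ι : Type*} [Fintype ι]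
    (A : ι → Set (EuclideanSpace ℝ (Fin d))) (hA : ∀ l, MeasurableSet (A l))
    (hA' : ∀ l, volume (A l) < ⊤) :
    ∫⁻ ω, ∑' t : ι ↪ ℕ, ∏ l, (A l).indicator (fun _ => (1 : ENNReal)) (X (t l) ω) ∂P =
      ∏ l, ENNReal.ofReal s * volume (A l) := by
  classical
  have hCm := measurableSet_atom hA
  have hCf : ∀ T, volume (atom A T) < ⊤ := fun T => by
    refine (measure_mono (t := ⋃ l, A l) fun x hx => Set.mem_iUnion.mpr hx.1).trans_lt ?_
    exact (measure_iUnion_le _).trans_lt (by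
      rw [tsum_fintype]; exact ENNReal.sum_lt_top.mpr fun l _ => hA' l)
  -- The product of sums is expanded: `τ` chooses one atom for every `l`, and contributes only if
  -- the atom of `l` lies in `A l`.
  have h1 : ∀ ω, ∑' t : ι ↪ ℕ, ∏ l, (A l).indicator (fun _ => (1 : ENNReal)) (X (t l) ω) =
      ∑ τ : ι → Finset ι, (∏ l, if l ∈ τ l then (1 : ENNReal) else 0) *
        ∏ T, descFact (count X (atom A T) ω) (Fintype.card {l // τ l = T}) := by
    intro ω
    have h2 : ∀ t : ι ↪ ℕ, ∏ l, (A l).indicator (fun _ => (1 : ENNReal)) (X (t l) ω) =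
        ∑ τ : ι → Finset ι, (∏ l, if l ∈ τ l then (1 : ENNReal) else 0) *
          ∏ l, {n | X n ω ∈ atom A (τ l)}.indicator (fun _ => (1 : ENNReal)) (t l) := by
      intro t
      simp_rw [indicator_eq_sum_atom A _ (X _ ω), Finset.prod_univ_sum, Fintype.piFinset_univ,
        Finset.prod_mul_distrib]
      rfl
    simp_rw [h2]
    rw [Summable.tsum_finsetSum fun _ _ => ENNReal.summable]
    refine Finset.sum_congr rfl fun τ _ => ?_
    rw [ENNReal.tsum_mul_left, tsum_embedding_prod_indicator
      (fun T => {n | X n ω ∈ atom A T}) _ τ]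
    · rfl
    · intro T T' hT
      exact Set.disjoint_left.mpr fun n hn hn' =>
        Set.disjoint_left.mp (disjoint_atom A hT) hn hn'
  simp_rw [h1]
  rw [lintegral_finsetSum _ fun τ _ => Measurable.const_mul (Finset.measurable_prod _ fun T _ =>
    measurable_descFact_count hX.measurable (hCm T) _) _]
  -- The same decomposition on the side of the volumes, so that the two expansions match term by
  -- term in `τ`.
  have h3 : ∀ l, ENNReal.ofReal s * volume (A l) =
      ∑ T : Finset ι, (if l ∈ T then 1 else 0) * (ENNReal.ofReal s * volume (atom A T)) := by
    intro l
    rw [← lintegral_indicator_one (hA l)]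
    have : ∀ x, (A l).indicator (1 : EuclideanSpace ℝ (Fin d) → ENNReal) x =
      ∑ T : Finset ι, (if l ∈ T then 1 else 0) * (atom A T).indicator (fun _ => 1) x :=
      indicator_eq_sum_atom A l
    simp_rw [this]
    rw [lintegral_finsetSum _ fun T _ => (measurable_const.indicator (hCm T)).const_mul _,
      Finset.mul_sum]
    refine Finset.sum_congr rfl fun T _ => ?_
    rw [lintegral_const_mul _ (measurable_const.indicator (hCm T))]
    have : ∫⁻ x, (atom A T).indicator (fun _ => (1 : ENNReal)) x = volume (atom A T) :=
      lintegral_indicator_one (hCm T)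
    rw [this]
    ring
  simp_rw [h3, Finset.prod_univ_sum, Fintype.piFinset_univ, Finset.prod_mul_distrib]
  refine Finset.sum_congr rfl fun τ _ => ?_
  rw [lintegral_const_mul _ (Finset.measurable_prod _ fun T _ =>
    measurable_descFact_count hX.measurable (hCm T) _),
    lintegral_prod_descFact_count hX _ hCm hCf (disjoint_atom A)]
  congr 1
  rw [← Finset.prod_mul_distrib, ← Finset.prod_fiberwise Finset.univ τ]
  refine Finset.prod_congr rfl fun T _ => ?_
  rw [Finset.prod_congr rfl (g := fun _ => ENNReal.ofReal s * volume (atom A T))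
    (fun l hl => by rw [(Finset.mem_filter.mp hl).2]), Finset.prod_const, Fintype.card_subtype]

/-- The factorial moment measures of a homogeneous Poisson point process are the powers of its
intensity measure. -/
theorem sum_map_embedding_eq_pi (hX : IsHomogeneousPPP P s X) (ι : Type*) [Fintype ι] :
    Measure.sum (fun t : ι ↪ ℕ => P.map fun ω l => X (t l) ω) =
      Measure.pi fun _ : ι => ENNReal.ofReal s •
        (volume : Measure (EuclideanSpace ℝ (Fin d))) := by
  have hm : ∀ t : ι ↪ ℕ, Measurable fun ω l => X (t l) ω := fun t =>
    measurable_pi_lambda _ fun l => hX.measurable _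
  symm
  refine Measure.pi_eq_generateFrom
    (C := fun _ => {B : Set (EuclideanSpace ℝ (Fin d)) | MeasurableSet B ∧ volume B < ⊤})
    (fun _ => ?_) (fun _ => ?_) (fun _ => ?_) fun A hA => ?_
  · refine le_antisymm (MeasurableSpace.generateFrom_le fun B hB => hB.1) fun B hB => ?_
    -- Sets of finite volume already generate the Borel σ-algebra: cut with balls.
    have h1 : B = ⋃ n : ℕ, B ∩ Metric.ball 0 n := by
      rw [← Set.inter_iUnion, Metric.iUnion_ball_nat, Set.inter_univ]
    rw [h1]
    refine MeasurableSet.iUnion fun n => MeasurableSpace.measurableSet_generateFrom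
      ⟨hB.inter measurableSet_ball, ?_⟩
    exact (measure_mono Set.inter_subset_right).trans_lt measure_ball_lt_top
  · intro B hB B' hB' _
    exact ⟨hB.1.inter hB'.1, (measure_mono Set.inter_subset_left).trans_lt hB.2⟩
  · refine ⟨fun n => Metric.ball 0 n, fun n => ⟨measurableSet_ball, measure_ball_lt_top⟩,
      fun n => ?_, Metric.iUnion_ball_nat 0⟩
    rw [Measure.smul_apply, smul_eq_mul]
    exact ENNReal.mul_lt_top ENNReal.ofReal_lt_top measure_ball_lt_top
  · rw [Measure.sum_apply _ (MeasurableSet.univ_pi fun l => (hA l).1)]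
    simp_rw [Measure.smul_apply, smul_eq_mul]
    rw [← tsum_embedding_rectangle hX A (fun l => (hA l).1) (fun l => (hA l).2), lintegral_tsum]
    · refine tsum_congr fun t => ?_
      rw [← lintegral_indicator_one (MeasurableSet.univ_pi fun l => (hA l).1),
        lintegral_map (measurable_one.indicator (MeasurableSet.univ_pi fun l => (hA l).1))
          (hm t)]
      refine lintegral_congr fun ω => ?_
      by_cases h : ∀ l, X (t l) ω ∈ A l
      · rw [Set.indicator_of_mem (by simpa using h)]
        exact (Finset.prod_eq_one fun l _ => Set.indicator_of_mem (h l) _).symm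
      · rw [Set.indicator_of_notMem (by simpa using h)]
        push Not at h
        obtain ⟨l, hl⟩ := h
        exact (Finset.prod_eq_zero (Finset.mem_univ l) (Set.indicator_of_notMem hl _)).symm
    · intro t
      exact (Finset.measurable_prod _ fun l _ =>
        (measurable_const.indicator (hA l).1).comp (hX.measurable _)).aemeasurable

end

/-! ### Integrals over product measures -/

section

variable {Z : Type*} [MeasurableSpace Z] (μ : Measure Z) [SigmaFinite μ]

theorem lintegral_pi_succ {m : ℕ} {f : Z → (Fin m → Z) → ENNReal}
    (hf : Measurable (Function.uncurry f)) :
    ∫⁻ x : Fin (m + 1) → Z, f (x 0) (fun l => x l.succ) ∂(Measure.pi fun _ => μ) =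
      ∫⁻ z, ∫⁻ y, f z y ∂(Measure.pi fun _ => μ) ∂μ := by
  have h := (measurePreserving_piFinSuccAbove (fun _ : Fin (m + 1) => μ) 0).lintegral_comp hf
  rw [lintegral_prod _ hf.aemeasurable] at h
  exact h

theorem lintegral_pi_prod {m : ℕ} {f : Fin m → Z → ENNReal} (hf : ∀ l, Measurable (f l)) :
    ∫⁻ x : Fin m → Z, ∏ l, f l (x l) ∂(Measure.pi fun _ => μ) = ∏ l, ∫⁻ z, f l z ∂μ := by
  induction m with
  | zero => simp
  | succ m ih =>
    simp_rw [Fin.prod_univ_succ]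
    rw [lintegral_pi_succ μ (f := fun z y => f 0 z * ∏ l : Fin m, f l.succ (y l))]
    · have h1 : Measurable fun y : Fin m → Z => ∏ l : Fin m, f l.succ (y l) :=
        Finset.measurable_prod _ fun l _ => (hf _).comp (measurable_pi_apply l)
      simp_rw [lintegral_const_mul _ h1, ih fun l => hf l.succ]
      rw [lintegral_mul_const _ (hf 0)]
    · exact ((hf 0).comp measurable_fst).mul (Finset.measurable_prod _ fun l _ =>
        (hf _).comp ((measurable_pi_apply l).comp measurable_snd))

/-- With the root of the star fixed, the leaves are integrated independently, each giving the same
factor. -/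
theorem lintegral_pi_star {m : ℕ} {g : Z → ENNReal} (hg : Measurable g) {f : Z → Z → ENNReal}
    (hf : Measurable (Function.uncurry f)) :
    ∫⁻ x : Fin (m + 1) → Z, g (x 0) * ∏ l : Fin m, f (x 0) (x l.succ) ∂(Measure.pi fun _ => μ) =
      ∫⁻ z, g z * (∫⁻ y, f z y ∂μ) ^ m ∂μ := by
  rw [lintegral_pi_succ μ (f := fun z y => g z * ∏ l : Fin m, f z (y l))]
  · refine lintegral_congr fun z => ?_
    have h1 : ∀ l : Fin m, Measurable fun y : Fin m → Z => f z (y l) := fun l =>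
      hf.comp (measurable_const.prodMk (measurable_pi_apply l))
    rw [lintegral_const_mul _ (Finset.measurable_prod _ fun l _ => h1 l),
      lintegral_pi_prod μ (f := fun _ => f z) fun _ =>
        hf.comp (measurable_const.prodMk measurable_id)]
    simp
  · exact (hg.comp measurable_fst).mul (Finset.measurable_prod _ fun l _ =>
      hf.comp (measurable_fst.prodMk ((measurable_pi_apply l).comp measurable_snd)))

end

/-! ### Attaching weights and uniform variables -/

section

variable {Ω : Type*} [MeasurableSpace Ω] {P : Measure Ω} [IsProbabilityMeasure P] {d : ℕ} {s : ℝ}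
  {ν : Measure ℝ}
  {X : ℕ → Ω → EuclideanSpace ℝ (Fin d)} {W : ℕ → Ω → ℝ} {U : Sym2 ℕ → Ω → ℝ}

/-- The intensity measure of the weighted points. -/
noncomputable def markedIntensity (d : ℕ) (s : ℝ) (ν : Measure ℝ) :
    Measure (EuclideanSpace ℝ (Fin d) × ℝ) :=
  (ENNReal.ofReal s • (volume : Measure (EuclideanSpace ℝ (Fin d)))).prod ν

/-- An infinite multiple of Lebesgue measure is not σ-finite, so the scalar has to be recognized as
a coerced `NNReal`. -/
instance (d : ℕ) (s : ℝ) :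
    SigmaFinite (ENNReal.ofReal s • (volume : Measure (EuclideanSpace ℝ (Fin d)))) :=
  inferInstanceAs (SigmaFinite (s.toNNReal • (volume : Measure (EuclideanSpace ℝ (Fin d)))))

instance (d : ℕ) (s : ℝ) (ν : Measure ℝ) [IsProbabilityMeasure ν] :
    SigmaFinite (markedIntensity d s ν) := by
  unfold markedIntensity
  infer_instance

theorem map_weights_eq_pi (h : IsModelInput P s ν X W U) {ι : Type*} [Fintype ι] (t : ι ↪ ℕ) :
    P.map (fun ω l => W (t l) ω) = Measure.pi fun _ : ι => ν := by
  have h1 := (iIndepFun_iff_map_fun_eq_pi_map fun l : ι =>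
    (h.weight_measurable (t l)).aemeasurable).mp (h.weight_indep.precomp t.injective)
  simp_rw [h.weight_law] at h1
  exact h1

theorem map_unif_eq_pi (h : IsModelInput P s ν X W U) {ι : Type*} [Fintype ι] {e : ι → Sym2 ℕ}
    (he : e.Injective) :
    P.map (fun ω l => U (e l) ω) =
      Measure.pi fun _ : ι => volume.restrict (Set.Icc (0 : ℝ) 1) := by
  have h1 := (iIndepFun_iff_map_fun_eq_pi_map fun l : ι =>
    (h.unif_measurable (e l)).aemeasurable).mp (h.unif_indep.precomp he)
  simp_rw [h.unif_law] at h1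
  exact h1

theorem map_points_weights [IsProbabilityMeasure ν] (h : IsModelInput P s ν X W U) {ι : Type*} [Fintype ι] (t : ι ↪ ℕ) :
    P.map (fun ω => ((fun l => X (t l) ω), (fun l => W (t l) ω))) =
      (P.map fun ω l => X (t l) ω).prod (Measure.pi fun _ : ι => ν) := by
  rw [← map_weights_eq_pi h t]
  refine (indepFun_iff_map_prod_eq_prod_map_map ?_ ?_).mp ?_
  · exact (measurable_pi_lambda _ fun l => h.ppp.measurable _).aemeasurable
  · exact (measurable_pi_lambda _ fun l => h.weight_measurable _).aemeasurable
  · exact h.indep_points_weights.comp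
      (φ := fun x : ℕ → EuclideanSpace ℝ (Fin d) => fun l : ι => x (t l))
      (ψ := fun w : ℕ → ℝ => fun l : ι => w (t l))
      (measurable_pi_lambda _ fun l => measurable_pi_apply _)
      (measurable_pi_lambda _ fun l => measurable_pi_apply _)

theorem map_points_weights_unif [IsProbabilityMeasure ν] (h : IsModelInput P s ν X W U) {ι κ : Type*} [Fintype ι]
    [Fintype κ] (t : ι ↪ ℕ) {e : κ → Sym2 ℕ} (he : e.Injective) :
    P.map (fun ω => ((fun l => (X (t l) ω, W (t l) ω)), (fun l => U (e l) ω))) =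
      (P.map fun ω l => (X (t l) ω, W (t l) ω)).prod
        (Measure.pi fun _ : κ => volume.restrict (Set.Icc (0 : ℝ) 1)) := by
  rw [← map_unif_eq_pi h he]
  refine (indepFun_iff_map_prod_eq_prod_map_map ?_ ?_).mp ?_
  · exact (measurable_pi_lambda _ fun l =>
      (h.ppp.measurable _).prodMk (h.weight_measurable _)).aemeasurable
  · exact (measurable_pi_lambda _ fun l => h.unif_measurable _).aemeasurable
  · exact h.indep_points_weights_unif.comp
      (φ := fun x : (ℕ → EuclideanSpace ℝ (Fin d)) × (ℕ → ℝ) =>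
        fun l : ι => (x.1 (t l), x.2 (t l)))
      (ψ := fun u : Sym2 ℕ → ℝ => fun l : κ => u (e l))
      (by fun_prop) (by fun_prop)

/-- The factorial moment measures of the marked point process. -/
theorem sum_map_marked_eq_pi [IsProbabilityMeasure ν] (h : IsModelInput P s ν X W U) (ι : Type*) [Fintype ι] :
    Measure.sum (fun t : ι ↪ ℕ => P.map fun ω l => (X (t l) ω, W (t l) ω)) =
      Measure.pi fun _ : ι => markedIntensity d s ν := by
  have h1 : ∀ t : ι ↪ ℕ, P.map (fun ω l => (X (t l) ω, W (t l) ω)) =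
      ((P.map fun ω l => X (t l) ω).prod (Measure.pi fun _ : ι => ν)).map
        (MeasurableEquiv.arrowProdEquivProdArrow (EuclideanSpace ℝ (Fin d)) ℝ ι).symm := by
    intro t
    rw [← map_points_weights h t, Measure.map_map (MeasurableEquiv.measurable _)]
    · rfl
    · exact (measurable_pi_lambda _ fun l => h.ppp.measurable _).prodMk
        (measurable_pi_lambda _ fun l => h.weight_measurable _)
  simp_rw [h1]
  rw [← Measure.map_sum (MeasurableEquiv.measurable _).aemeasurable, ← Measure.prod_sum_left,
    sum_map_embedding_eq_pi h.ppp]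
  exact ((measurePreserving_arrowProdEquivProdArrow _ _ ι
    (fun _ => ENNReal.ofReal s • (volume : Measure (EuclideanSpace ℝ (Fin d))))
    (fun _ => ν)).symm).map_eq

end

/-! ### Factorial moments of the degrees -/

/-- The probability that a uniform variable on `[0,1]` is smaller than `p`. -/
noncomputable def unifBelow (p : ℝ) : ENNReal := volume.restrict (Set.Icc (0 : ℝ) 1) (Set.Iio p)

theorem measurable_unifBelow : Measurable unifBelow :=
  Monotone.measurable fun _ _ h => measure_mono (Set.Iio_subset_Iio h)

theorem unifBelow_eq_ofReal {p : ℝ} (hp : p ∈ Set.Icc (0 : ℝ) 1) :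
    unifBelow p = ENNReal.ofReal p := by
  rw [unifBelow, Measure.restrict_apply measurableSet_Iio]
  have : Set.Iio p ∩ Set.Icc 0 1 = Set.Ico 0 p := by
    ext x
    simp only [Set.mem_inter_iff, Set.mem_Iio, Set.mem_Icc, Set.mem_Ico]
    constructor
    · rintro ⟨h1, h2, h3⟩
      exact ⟨h2, h1⟩
    · rintro ⟨h1, h2⟩
      exact ⟨h2, h1, h2.le.trans hp.2⟩
  rw [this, Real.volume_Ico, sub_zero]

/-- The sum over a vertex and a tuple of distinct other vertices, as a sum over embeddings. -/
theorem tsum_embedding_succ {m : ℕ} (F : ℕ → (Fin m → ℕ) → ENNReal)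
    (hF : ∀ i j, (∃ l, j l = i) → F i j = 0) :
    ∑' i, ∑' j : Fin m ↪ ℕ, F i j = ∑' t : Fin (m + 1) ↪ ℕ, F (t 0) (fun l => t l.succ) := by
  rw [← ENNReal.tsum_prod (f := fun i (j : Fin m ↪ ℕ) => F i j)]
  let e : (Fin (m + 1) ↪ ℕ) → ℕ × (Fin m ↪ ℕ) := fun t =>
    (t 0, ⟨fun l => t l.succ, fun l l' h => Fin.succ_injective _ (t.injective h)⟩)
  have he : e.Injective := by
    intro t t' h
    ext l
    have h2 := congrArg (fun p : ℕ × (Fin m ↪ ℕ) => p.2) h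
    refine Fin.cases (congrArg Prod.fst h) (fun l => ?_) l
    exact DFunLike.congr_fun h2 l
  refine (he.tsum_eq (f := fun p : ℕ × (Fin m ↪ ℕ) => F p.1 p.2) fun p hp => ?_).symm
  have h1 : ∀ l, p.2 l ≠ p.1 := fun l hl => hp (hF _ _ ⟨l, hl⟩)
  refine ⟨⟨Fin.cons p.1 p.2, ?_⟩, ?_⟩
  · rw [Fin.cons_injective_iff]
    exact ⟨fun ⟨l, hl⟩ => h1 l hl, p.2.injective⟩
  · refine Prod.ext rfl ?_
    ext l
    rfl

section

variable {Ω : Type*} [MeasurableSpace Ω] {P : Measure Ω} [IsProbabilityMeasure P] {d : ℕ} {s : ℝ}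
  {ν : Measure ℝ} {a v : ℝ} {φ : ℝ → ℝ}
  {X : ℕ → Ω → EuclideanSpace ℝ (Fin d)} {W : ℕ → Ω → ℝ} {U : Sym2 ℕ → Ω → ℝ}

theorem measurable_volume_real_ball (d : ℕ) : Measurable fun r : ℝ =>
    volume.real (Metric.ball (0 : EuclideanSpace ℝ (Fin d)) r) := by
  refine Monotone.measurable fun r r' h => ?_
  exact ENNReal.toReal_mono measure_ball_lt_top.ne (measure_mono (Metric.ball_subset_ball h))

theorem measurable_connProb (hφ : Measurable φ) :
    Measurable fun p : (EuclideanSpace ℝ (Fin d) × ℝ) × (EuclideanSpace ℝ (Fin d) × ℝ) =>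
      connProb d a φ v p.1.1 p.1.2 p.2.1 p.2.2 := by
  have h1 : Measurable fun p : (EuclideanSpace ℝ (Fin d) × ℝ) ×
      (EuclideanSpace ℝ (Fin d) × ℝ) => dist p.1.1 p.2.1 := by fun_prop
  have h2 := (measurable_volume_real_ball d).comp h1
  have h3 : Measurable fun p : (EuclideanSpace ℝ (Fin d) × ℝ) ×
      (EuclideanSpace ℝ (Fin d) × ℝ) => v * (min p.1.2 p.2.2 * max p.1.2 p.2.2 ^ a) := by
    fun_prop
  exact hφ.comp (h2.div h3)

theorem measurableSet_adj (hφ : Measurable φ) (hX : ∀ n, Measurable (X n))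
    (hW : ∀ n, Measurable (W n)) (hU : ∀ e, Measurable (U e)) (i j : ℕ) :
    MeasurableSet {ω | (graph a φ v X W U ω).Adj i j} := by
  by_cases hij : i = j
  · subst hij
    simp
  · have : {ω | (graph a φ v X W U ω).Adj i j} =
        {ω | U s(i, j) ω < connProb d a φ v (X i ω) (W i ω) (X j ω) (W j ω)} := by
      ext ω
      exact and_iff_right hij
    rw [this]
    have h1 : Measurable fun ω => ((X i ω, W i ω), (X j ω, W j ω)) :=
      ((hX i).prodMk (hW i)).prodMk ((hX j).prodMk (hW j))
    have h2 := (measurable_connProb (d := d) (a := a) (v := v) hφ).comp h1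
    exact measurableSet_lt (hU _) h2

theorem measurable_degree (hφ : Measurable φ) (hX : ∀ n, Measurable (X n))
    (hW : ∀ n, Measurable (W n)) (hU : ∀ e, Measurable (U e)) (i : ℕ) :
    Measurable fun ω => ((graph a φ v X W U ω).neighborSet i).encard := by
  refine measurable_encard.comp ?_
  rw [measurable_set_iff]
  intro j
  exact (measurableSet_setOfPred (p := fun ω => (graph a φ v X W U ω).Adj i j)).mp
    (measurableSet_adj hφ hX hW hU i j)

/-- The expected number of neighbors of a vertex with position and weight `z`. -/
noncomputable def meanDegree (a : ℝ) (φ : ℝ → ℝ) (v : ℝ) (d : ℕ) (s : ℝ) (ν : Measure ℝ)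
    (z : EuclideanSpace ℝ (Fin d) × ℝ) : ENNReal :=
  ∫⁻ z', unifBelow (connProb d a φ v z.1 z.2 z'.1 z'.2) ∂(markedIntensity d s ν)

theorem measurable_meanDegree [IsProbabilityMeasure ν] (hφ : Measurable φ) :
    Measurable (meanDegree a φ v d s ν) :=
  Measurable.lintegral_prod_right' (f := fun p : (EuclideanSpace ℝ (Fin d) × ℝ) ×
    (EuclideanSpace ℝ (Fin d) × ℝ) => unifBelow (connProb d a φ v p.1.1 p.1.2 p.2.1 p.2.2))
    (measurable_unifBelow.comp (measurable_connProb hφ))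

/-- The edges of a star with distinct leaves carry distinct uniform variables. These are independent
of each other and of points and weights, so integrating them out replaces every edge indicator by
its probability. -/
theorem lintegral_star_embedding [IsProbabilityMeasure ν] (h : IsModelInput P s ν X W U)
    (hφ : Measurable φ) {g : EuclideanSpace ℝ (Fin d) × ℝ → ENNReal} (hg : Measurable g) {m : ℕ}
    (t : Fin (m + 1) ↪ ℕ) :
    ∫⁻ ω, g (X (t 0) ω, W (t 0) ω) * ∏ l : Fin m,
        ((graph a φ v X W U ω).neighborSet (t 0)).indicator (fun _ => (1 : ENNReal)) (t l.succ) ∂P =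
      ∫⁻ z, g (z 0) * ∏ l : Fin m,
        unifBelow (connProb d a φ v (z 0).1 (z 0).2 (z l.succ).1 (z l.succ).2)
        ∂(P.map fun ω l => (X (t l) ω, W (t l) ω)) := by
  have he : Function.Injective fun l : Fin m => s(t 0, t l.succ) := by
    intro l l' hl
    have h1 := Sym2.congr_right.mp hl
    exact Fin.succ_injective _ (t.injective h1)
  let G : (Fin (m + 1) → EuclideanSpace ℝ (Fin d) × ℝ) × (Fin m → ℝ) → ENNReal := fun p =>
    g (p.1 0) * ∏ l : Fin m, (Set.Iio (connProb d a φ v (p.1 0).1 (p.1 0).2 (p.1 l.succ).1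
      (p.1 l.succ).2)).indicator (fun _ => (1 : ENNReal)) (p.2 l)
  have hind : ∀ l : Fin m, Measurable fun p : (Fin (m + 1) → EuclideanSpace ℝ (Fin d) × ℝ) ×
      (Fin m → ℝ) => (Set.Iio (connProb d a φ v (p.1 0).1 (p.1 0).2 (p.1 l.succ).1
      (p.1 l.succ).2)).indicator (fun _ => (1 : ENNReal)) (p.2 l) := by
    intro l
    have h1 : MeasurableSet {p : (Fin (m + 1) → EuclideanSpace ℝ (Fin d) × ℝ) × (Fin m → ℝ) |
        p.2 l < connProb d a φ v (p.1 0).1 (p.1 0).2 (p.1 l.succ).1 (p.1 l.succ).2} :=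
      measurableSet_lt (by fun_prop) ((measurable_connProb hφ).comp
        (f := fun p : (Fin (m + 1) → EuclideanSpace ℝ (Fin d) × ℝ) × (Fin m → ℝ) =>
          (p.1 0, p.1 l.succ)) (by fun_prop))
    exact measurable_const.indicator h1
  have hG : Measurable G :=
    (hg.comp (by fun_prop)).mul (Finset.measurable_prod _ fun l _ => hind l)
  have hmeas : Measurable fun ω => ((fun l => (X (t l) ω, W (t l) ω)),
      (fun l : Fin m => U s(t 0, t l.succ) ω)) :=
    (measurable_pi_lambda _ fun l => (h.ppp.measurable _).prodMk (h.weight_measurable _)).prodMk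
      (measurable_pi_lambda _ fun l => h.unif_measurable _)
  have h1 : ∀ ω, g (X (t 0) ω, W (t 0) ω) * ∏ l : Fin m,
      ((graph a φ v X W U ω).neighborSet (t 0)).indicator (fun _ => (1 : ENNReal)) (t l.succ) =
      G ((fun l => (X (t l) ω, W (t l) ω)), (fun l : Fin m => U s(t 0, t l.succ) ω)) := by
    intro ω
    refine congrArg _ (Finset.prod_congr rfl fun l _ => ?_)
    have h2 : t 0 ≠ t l.succ := fun h3 => (Fin.succ_ne_zero l).symm (t.injective h3)
    have h3 : t l.succ ∈ (graph a φ v X W U ω).neighborSet (t 0) ↔ U s(t 0, t l.succ) ω ∈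
        Set.Iio (connProb d a φ v (X (t 0) ω) (W (t 0) ω) (X (t l.succ) ω) (W (t l.succ) ω)) :=
      and_iff_right h2
    simp only [Set.indicator, h3]
  simp_rw [h1]
  rw [← lintegral_map (μ := P) hG hmeas, map_points_weights_unif h t he, lintegral_prod _
    hG.aemeasurable]
  refine lintegral_congr fun z => ?_
  have h4 : ∀ l : Fin m, Measurable ((Set.Iio (connProb d a φ v (z 0).1 (z 0).2 (z l.succ).1
      (z l.succ).2)).indicator (fun _ => (1 : ENNReal))) := fun l =>
    measurable_const.indicator measurableSet_Iio
  simp only [G]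
  have h5 : Measurable fun u : Fin m → ℝ => ∏ l, (Set.Iio (connProb d a φ v (z 0).1 (z 0).2
      (z l.succ).1 (z l.succ).2)).indicator (fun _ => (1 : ENNReal)) (u l) :=
    Finset.measurable_prod _ fun l _ => (h4 l).comp (measurable_pi_apply l)
  rw [lintegral_const_mul _ h5, lintegral_pi_prod _ h4]
  refine congrArg _ (Finset.prod_congr rfl fun l _ => ?_)
  exact lintegral_indicator_one measurableSet_Iio

/-- The factorial moments of the degrees. -/
theorem lintegral_descFact_degree [IsProbabilityMeasure ν] (h : IsModelInput P s ν X W U)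
    (hφ : Measurable φ) {g : EuclideanSpace ℝ (Fin d) × ℝ → ENNReal} (hg : Measurable g) (m : ℕ) :
    ∫⁻ ω, ∑' i, g (X i ω, W i ω) * descFact ((graph a φ v X W U ω).neighborSet i).encard m ∂P =
      ∫⁻ z, g z * meanDegree a φ v d s ν z ^ m ∂(markedIntensity d s ν) := by
  have h1 : ∀ ω, ∑' i, g (X i ω, W i ω) *
      descFact ((graph a φ v X W U ω).neighborSet i).encard m =
      ∑' t : Fin (m + 1) ↪ ℕ, g (X (t 0) ω, W (t 0) ω) * ∏ l : Fin m,
        ((graph a φ v X W U ω).neighborSet (t 0)).indicator (fun _ => (1 : ENNReal))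
          (t l.succ) := by
    intro ω
    simp_rw [← tsum_embedding_indicator, ← ENNReal.tsum_mul_left]
    refine tsum_embedding_succ (fun i j => g (X i ω, W i ω) * ∏ l,
      ((graph a φ v X W U ω).neighborSet i).indicator (fun _ => (1 : ENNReal)) (j l)) ?_
    rintro i j ⟨l, rfl⟩
    -- Tuples with a leaf equal to the root contribute nothing, since the graph has no loops.
    rw [Finset.prod_eq_zero (Finset.mem_univ l) (by simp), mul_zero]
  have hadj : ∀ i j, Measurable fun ω =>
      ((graph a φ v X W U ω).neighborSet i).indicator (fun _ => (1 : ENNReal)) j := fun i j =>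
    measurable_const.indicator (measurableSet_adj hφ h.ppp.measurable h.weight_measurable
      h.unif_measurable i j)
  simp_rw [h1]
  rw [lintegral_tsum]
  · simp_rw [lintegral_star_embedding h hφ hg]
    rw [← lintegral_sum_measure, sum_map_marked_eq_pi h]
    exact lintegral_pi_star _ hg (f := fun z z' => unifBelow (connProb d a φ v z.1 z.2 z'.1 z'.2))
      (measurable_unifBelow.comp (measurable_connProb hφ))
  · intro t
    exact ((hg.comp ((h.ppp.measurable _).prodMk (h.weight_measurable _))).mul
      (Finset.measurable_prod _ fun l _ => hadj _ _)).aemeasurable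

end

/-! ### Recovering masses from factorial moments -/

theorem descFactorial_add_eq (n k j : ℕ) :
    n.descFactorial (k + j) = k.factorial * j.factorial * (n.choose k * (n - k).choose j) := by
  rw [← Nat.descFactorial_mul_descFactorial (Nat.le_add_right k j), Nat.add_sub_cancel_left,
    Nat.descFactorial_eq_factorial_mul_choose, Nat.descFactorial_eq_factorial_mul_choose]
  ring

/-- This is (1 - 1)^(n - k) = 1{n = k} multiplied by a binomial coefficient. Even and odd terms
stand on opposite sides to avoid subtraction, which is truncated in `ℕ` and `ENNReal`. -/
theorem sum_choose_even_eq_odd (n k N : ℕ) (hN : n < N) :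
    ∑ j ∈ (Finset.range N).filter Even, n.choose k * (n - k).choose j =
      ∑ j ∈ (Finset.range N).filter (fun j => ¬ Even j), n.choose k * (n - k).choose j +
        (if n = k then 1 else 0) := by
  rcases lt_or_ge n k with hn | hn
  · simp [Nat.choose_eq_zero_of_lt hn, hn.ne]
  · have h1 : ∑ j ∈ Finset.range N, ((-1) ^ j * (n - k).choose j : ℤ) =
        if n - k = 0 then 1 else 0 := by
      rw [← Int.alternating_sum_range_choose (n := n - k)]
      refine (Finset.sum_subset (Finset.range_subset_range.mpr (by omega)) fun j _ hj => ?_).symm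
      rw [Finset.mem_range, not_lt] at hj
      rw [Nat.choose_eq_zero_of_lt (by omega)]
      simp
    rw [← Finset.sum_filter_add_sum_filter_not _ Even] at h1
    have h2 : ∑ j ∈ (Finset.range N).filter Even, ((-1) ^ j * (n - k).choose j : ℤ) =
        ∑ j ∈ (Finset.range N).filter Even, ((n - k).choose j : ℤ) :=
      Finset.sum_congr rfl fun j hj => by rw [(Finset.mem_filter.mp hj).2.neg_one_pow, one_mul]
    have h3 : ∑ j ∈ (Finset.range N).filter (fun j => ¬ Even j),
        ((-1) ^ j * (n - k).choose j : ℤ) =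
        -∑ j ∈ (Finset.range N).filter (fun j => ¬ Even j), ((n - k).choose j : ℤ) := by
      rw [← Finset.sum_neg_distrib]
      exact Finset.sum_congr rfl fun j hj => by
        rw [(Nat.not_even_iff_odd.mp (Finset.mem_filter.mp hj).2).neg_one_pow, neg_one_mul]
    rw [h2, h3] at h1
    rw [← Finset.mul_sum, ← Finset.mul_sum]
    zify
    by_cases hnk : n = k
    · subst hnk
      simp only [Nat.choose_self, if_true, Nat.sub_self] at h1 ⊢
      push_cast
      linarith
    · rw [if_neg (by omega)] at h1
      rw [if_neg (by exact_mod_cast hnk)]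
      have h4 : ∑ j ∈ (Finset.range N).filter Even, ((n - k).choose j : ℤ) =
        ∑ j ∈ (Finset.range N).filter (fun j => ¬ Even j), ((n - k).choose j : ℤ) := by linarith
      rw [h4]
      simp

theorem tsum_descFact_even_eq_odd (n k : ℕ) :
    ∑' j : ℕ, (if Even j then descFact n (k + j) / (k.factorial * j.factorial) else 0) =
      ∑' j : ℕ, (if ¬ Even j then descFact n (k + j) / (k.factorial * j.factorial) else 0) +
        (if n = k then 1 else 0) := by
  have h1 : ∀ j : ℕ, descFact n (k + j) / (k.factorial * j.factorial) =
      ((n.choose k * (n - k).choose j : ℕ) : ENNReal) := by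
    intro j
    rw [descFact_natCast, descFactorial_add_eq, Nat.cast_mul]
    have h2 : ((k.factorial * j.factorial : ℕ) : ENNReal) = k.factorial * j.factorial := by
      push_cast; rfl
    rw [← h2, ENNReal.mul_div_right_comm, ENNReal.div_self, one_mul]
    · exact_mod_cast (Nat.mul_pos k.factorial_pos j.factorial_pos).ne'
    · exact ENNReal.natCast_ne_top _
  have h3 : ∀ j ∉ Finset.range (n + 1), ((n.choose k * (n - k).choose j : ℕ) : ENNReal) = 0 := by
    intro j hj
    rw [Finset.mem_range, not_lt] at hj
    rw [Nat.choose_eq_zero_of_lt (show n - k < j by omega)]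
    simp
  simp_rw [h1]
  rw [tsum_eq_sum (s := Finset.range (n + 1)) fun j hj => by rw [h3 j hj, ite_self],
    tsum_eq_sum (s := Finset.range (n + 1)) fun j hj => by rw [h3 j hj, ite_self],
    ← Finset.sum_filter, ← Finset.sum_filter]
  have h4 := sum_choose_even_eq_odd n k (n + 1) n.lt_succ_self
  have h5 := congrArg (Nat.cast : ℕ → ENNReal) h4
  push_cast at h5 ⊢
  exact h5

/-- A sequence of masses is determined by its factorial moments, if these do not grow too fast. -/
theorem eq_of_factorial_moments {p q b : ℕ → ENNReal} {k : ℕ}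
    (hp : ∀ m, ∑' n : ℕ, p n * descFact n m = b m) (hq : ∀ m, ∑' n : ℕ, q n * descFact n m = b m)
    (hb : ∑' j : ℕ, b (k + j) / (k.factorial * j.factorial) ≠ ⊤) : p k = q k := by
  have key : ∀ p : ℕ → ENNReal, (∀ m, ∑' n : ℕ, p n * descFact n m = b m) →
      ∑' j : ℕ, (if Even j then b (k + j) / (k.factorial * j.factorial) else 0) =
      ∑' j : ℕ, (if ¬ Even j then b (k + j) / (k.factorial * j.factorial) else 0) + p k := by
    intro p hp
    have h1 : ∀ (Q : ℕ → Prop) [DecidablePred Q],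
        ∑' j : ℕ, (if Q j then b (k + j) / (k.factorial * j.factorial) else 0) =
        ∑' n : ℕ, p n * ∑' j : ℕ,
          (if Q j then descFact n (k + j) / (k.factorial * j.factorial) else 0) := by
      intro Q _
      simp_rw [← ENNReal.tsum_mul_left]
      rw [ENNReal.tsum_comm]
      refine tsum_congr fun j => ?_
      split_ifs
      · rw [← hp, div_eq_mul_inv, ← ENNReal.tsum_mul_right]
        refine tsum_congr fun n => ?_
        rw [div_eq_mul_inv, mul_assoc]
      · simp
    rw [h1 Even, h1 fun j => ¬ Even j]
    simp_rw [tsum_descFact_even_eq_odd, mul_add]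
    rw [ENNReal.tsum_add]
    congr 1
    rw [tsum_eq_single k fun n hn => by simp [hn]]
    simp
  -- Finiteness of the odd part permits cancelling it; this is the only use of the growth condition.
  have hfin : ∑' j : ℕ, (if ¬ Even j then b (k + j) / (k.factorial * j.factorial) else 0) ≠ ⊤ := by
    refine ne_top_of_le_ne_top hb (ENNReal.tsum_le_tsum fun j => ?_)
    split_ifs
    · exact zero_le
    · exact le_rfl
  exact (ENNReal.add_right_inj hfin).mp ((key p hp).symm.trans (key q hq))

/-- Geometric growth is beaten by the factor 1/j!: the sum is at most a multiple of the exponential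
series at `K`. -/
theorem tsum_div_factorial_ne_top {b : ℕ → ENNReal} {C : ENNReal} {K : NNReal} (hC : C ≠ ⊤) (k : ℕ)
    (hb : ∀ m, b m ≤ C * (K : ENNReal) ^ m) :
    ∑' j : ℕ, b (k + j) / (k.factorial * j.factorial) ≠ ⊤ := by
  have h1 : ∀ j : ℕ, b (k + j) / (k.factorial * j.factorial) ≤
      C * (K : ENNReal) ^ k * ENNReal.ofReal ((K : ℝ) ^ j / j.factorial) := by
    intro j
    rw [ENNReal.ofReal_div_of_pos (by positivity), ENNReal.ofReal_pow (by positivity),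
      ENNReal.ofReal_coe_nnreal, ENNReal.ofReal_natCast, ← mul_div_assoc, mul_assoc C, ← pow_add]
    refine ENNReal.div_le_div (hb _) ?_
    have : (1 : ENNReal) ≤ k.factorial := by exact_mod_cast k.factorial_pos
    exact le_mul_of_one_le_left zero_le this
  refine ne_top_of_le_ne_top ?_ (ENNReal.tsum_le_tsum h1)
  rw [ENNReal.tsum_mul_left, ← ENNReal.ofReal_tsum_of_nonneg (fun j => by positivity)
    (Real.summable_pow_div_factorial _)]
  exact ENNReal.mul_ne_top (ENNReal.mul_ne_top hC (by finiteness)) ENNReal.ofReal_ne_top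

/-! ### Expected number of vertices of degree k -/

section

variable {Ω : Type*} [MeasurableSpace Ω] {P : Measure Ω} [IsProbabilityMeasure P] {d : ℕ} {s : ℝ}
  {ν : Measure ℝ} [IsProbabilityMeasure ν] {a v : ℝ} {φ : ℝ → ℝ}
  {X : ℕ → Ω → EuclideanSpace ℝ (Fin d)} {W : ℕ → Ω → ℝ} {U : Sym2 ℕ → Ω → ℝ}

/-- Splits by the value of `x`, with infinite degree kept as a separate case until it is excluded.
-/
theorem descFact_eq_tsum (x : ℕ∞) (m : ℕ) : descFact x m =
    (if x = ⊤ then 1 else 0) * descFact ⊤ m + ∑' n : ℕ, (if x = n then 1 else 0) * descFact n m := by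
  induction x with
  | top => simp
  | coe x =>
    rw [tsum_eq_single x fun n hn => by simp [hn.symm]]
    simp

theorem measurable_poisson_toNNReal (k : ℕ) :
    Measurable fun x : ENNReal => poissonMeasure x.toNNReal {k} := by
  simp_rw [poissonMeasure_singleton]
  fun_prop

/-- On sets of finite intensity where the mean degree is bounded, the expected number of vertices of
degree `k` is the integral of the Poisson probabilities. -/
theorem lintegral_degree_eq_of_bounded (h : IsModelInput P s ν X W U) (hφ : Measurable φ)
    {S : Set (EuclideanSpace ℝ (Fin d) × ℝ)} (hS : MeasurableSet S)
    (hS' : markedIntensity d s ν S ≠ ⊤) {K : NNReal} (hK : ∀ z ∈ S, meanDegree a φ v d s ν z ≤ K)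
    (k : ℕ) :
    ∫⁻ ω, ∑' i, S.indicator (fun _ => (1 : ENNReal)) (X i ω, W i ω) *
        (if ((graph a φ v X W U ω).neighborSet i).encard = k then 1 else 0) ∂P =
      ∫⁻ z in S, poissonMeasure (meanDegree a φ v d s ν z).toNNReal {k}
        ∂(markedIntensity d s ν) := by
  set D : ℕ → Ω → ℕ∞ := fun i ω => ((graph a φ v X W U ω).neighborSet i).encard with hD
  set g : EuclideanSpace ℝ (Fin d) × ℝ → ENNReal := S.indicator (fun _ => (1 : ENNReal)) with hg
  set μ := markedIntensity d s ν
  set Λ := meanDegree a φ v d s ν with hΛ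
  have hgm : Measurable g := measurable_const.indicator hS
  have hΛm : Measurable Λ := measurable_meanDegree hφ
  have hgX : ∀ i, Measurable fun ω => g (X i ω, W i ω) := fun i =>
    hgm.comp ((h.ppp.measurable _).prodMk (h.weight_measurable _))
  have hDm : ∀ (f : ℕ∞ → ENNReal) i, Measurable fun ω => f (D i ω) := fun f i =>
    (Measurable.of_discrete (f := f)).comp
      (measurable_degree hφ h.ppp.measurable h.weight_measurable h.unif_measurable i)
  have hT : ∀ f : ℕ∞ → ENNReal, Measurable fun ω => ∑' i, g (X i ω, W i ω) * f (D i ω) := fun f =>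
    Measurable.tsum fun i => (hgX i).mul (hDm f i)
  let b : ℕ → ENNReal := fun m => ∫⁻ z in S, Λ z ^ m ∂μ
  let p : ℕ → ENNReal := fun n =>
    ∫⁻ ω, ∑' i, g (X i ω, W i ω) * (if D i ω = n then 1 else 0) ∂P
  let p' : ENNReal := ∫⁻ ω, ∑' i, g (X i ω, W i ω) * (if D i ω = ⊤ then 1 else 0) ∂P
  have hb : ∀ m, b m ≤ μ S * (K : ENNReal) ^ m := by
    intro m
    calc b m ≤ ∫⁻ z in S, (K : ENNReal) ^ m ∂μ :=
          setLIntegral_mono measurable_const fun z hz => pow_le_pow_left' (hK z hz) m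
      _ = μ S * (K : ENNReal) ^ m := by rw [setLIntegral_const, mul_comm]
  have hmom : ∀ m, p' * descFact ⊤ m + ∑' n : ℕ, p n * descFact n m = b m := by
    intro m
    have h1 := lintegral_descFact_degree (a := a) (v := v) h hφ hgm m
    have h2 : ∫⁻ z, g z * Λ z ^ m ∂μ = b m := by
      simp only [b]
      rw [← lintegral_indicator hS]
      refine lintegral_congr fun z => ?_
      by_cases hz : z ∈ S <;> simp [hg, hz]
    rw [← h2, ← h1, ← lintegral_mul_const _ (hT fun x => if x = ⊤ then 1 else 0)]
    have h3 : ∀ n : ℕ, p n * descFact n m = ∫⁻ ω, (∑' i, g (X i ω, W i ω) *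
        (if D i ω = n then 1 else 0)) * descFact n m ∂P := fun n =>
      (lintegral_mul_const _ (hT fun x => if x = n then 1 else 0)).symm
    simp_rw [h3]
    rw [← lintegral_tsum fun n : ℕ =>
        ((hT fun x => if x = n then 1 else 0).mul_const _).aemeasurable,
      ← lintegral_add_left ((hT fun x => if x = ⊤ then 1 else 0).mul_const _)]
    refine lintegral_congr fun ω => ?_
    simp_rw [← ENNReal.tsum_mul_right]
    rw [ENNReal.tsum_comm, ← ENNReal.tsum_add]
    refine tsum_congr fun i => ?_
    rw [descFact_eq_tsum (D i ω) m, mul_add, ← ENNReal.tsum_mul_left, mul_assoc]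
    simp_rw [mul_assoc]
  -- Any mass on infinite degrees would make the first moment infinite, but it is bounded by `μ S *
  -- K`.
  have hp' : p' = 0 := by
    by_contra hne
    have h1 := hmom 1
    rw [descFact_top one_ne_zero, ENNReal.mul_top hne, top_add] at h1
    exact (ne_top_of_le_ne_top (ENNReal.mul_ne_top hS' (by finiteness)) (hb 1)) h1.symm
  have hp : ∀ m, ∑' n : ℕ, p n * descFact n m = b m := fun m => by
    rw [← hmom m, hp', zero_mul, zero_add]
  have hq : ∀ m, ∑' n : ℕ, (∫⁻ z in S, poissonMeasure (Λ z).toNNReal {n} ∂μ) * descFact n m =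
      b m := by
    intro m
    have hm : ∀ n : ℕ, Measurable fun z => poissonMeasure (Λ z).toNNReal {n} := fun n =>
      (measurable_poisson_toNNReal n).comp hΛm
    simp_rw [← lintegral_mul_const _ (hm _)]
    rw [← lintegral_tsum fun n => ((hm n).mul_const _).aemeasurable]
    refine setLIntegral_congr_fun hS fun z hz => ?_
    rw [tsum_poisson_descFact, ENNReal.coe_toNNReal]
    exact ne_top_of_le_ne_top ENNReal.coe_ne_top (hK z hz)
  exact eq_of_factorial_moments hp hq (tsum_div_factorial_ne_top hS' k hb)

/-- The expected number of vertices of degree `k` with position and weight in a set. -/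
theorem lintegral_degree_eq (h : IsModelInput P s ν X W U) (hφ : Measurable φ)
    (hfin : ∀ᵐ z ∂(markedIntensity d s ν), meanDegree a φ v d s ν z ≠ ⊤)
    {S : Set (EuclideanSpace ℝ (Fin d) × ℝ)} (hS : MeasurableSet S) (k : ℕ) :
    ∫⁻ ω, ∑' i, S.indicator (fun _ => (1 : ENNReal)) (X i ω, W i ω) *
        (if ((graph a φ v X W U ω).neighborSet i).encard = k then 1 else 0) ∂P =
      ∫⁻ z in S, poissonMeasure (meanDegree a φ v d s ν z).toNNReal {k}
        ∂(markedIntensity d s ν) := by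
  set D : ℕ → Ω → ℕ∞ := fun i ω => ((graph a φ v X W U ω).neighborSet i).encard with hD
  set μ := markedIntensity d s ν with hμ
  set Λ := meanDegree a φ v d s ν with hΛ
  have hΛm : Measurable Λ := measurable_meanDegree hφ
  have hXW : ∀ i, Measurable fun ω => (X i ω, W i ω) := fun i =>
    (h.ppp.measurable _).prodMk (h.weight_measurable _)
  have hDk : ∀ i, MeasurableSet {ω | D i ω = k} := fun i =>
    (measurable_degree hφ h.ppp.measurable h.weight_measurable h.unif_measurable i)
      (measurableSet_singleton (k : ℕ∞))
  -- The expected number of degree-k vertices, as a measure in the position and weight. Dropping the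
  -- degree condition is the zeroth moment, which gives `M ≤ μ`; hence μ-null sets may be ignored.
  let M : Measure (EuclideanSpace ℝ (Fin d) × ℝ) :=
    Measure.sum fun i => (P.restrict {ω | D i ω = k}).map fun ω => (X i ω, W i ω)
  have hM : ∀ T, MeasurableSet T → M T = ∫⁻ ω, ∑' i, T.indicator (fun _ => (1 : ENNReal))
      (X i ω, W i ω) * (if D i ω = k then 1 else 0) ∂P := by
    intro T hT
    rw [lintegral_tsum, Measure.sum_apply _ hT]
    · refine tsum_congr fun i => ?_
      rw [Measure.map_apply (hXW i) hT, Measure.restrict_apply (hXW i hT),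
        ← lintegral_indicator_one ((hXW i hT).inter (hDk i))]
      refine lintegral_congr fun ω => ?_
      by_cases h1 : (X i ω, W i ω) ∈ T <;> by_cases h2 : D i ω = k <;>
        simp [Set.indicator, h1, h2]
    · intro i
      have h1 : Measurable fun ω => (if D i ω = k then (1 : ENNReal) else 0) :=
        Measurable.ite (hDk i) measurable_const measurable_const
      exact (((measurable_const.indicator hT).comp (hXW i)).mul h1).aemeasurable
  have hMμ : M ≤ μ := by
    refine Measure.le_iff.mpr fun T hT => ?_
    have h1 := lintegral_descFact_degree (a := a) (v := v) h hφ
      (g := T.indicator fun _ => (1 : ENNReal)) (measurable_const.indicator hT) 0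
    simp only [descFact_zero, mul_one, pow_zero] at h1
    rw [lintegral_indicator hT, setLIntegral_const, one_mul] at h1
    rw [hM T hT, hμ, ← h1]
    refine lintegral_mono fun ω => ENNReal.tsum_le_tsum fun i => ?_
    refine mul_le_of_le_one_right zero_le ?_
    split_ifs <;> simp
  let N := μ.withDensity fun z => poissonMeasure (Λ z).toNNReal {k}
  -- These sets have finite intensity and bounded mean degree, and they increase to almost
  -- everything because Λ is finite almost everywhere.
  let T : ℕ → Set (EuclideanSpace ℝ (Fin d) × ℝ) := fun n =>
    spanningSets μ n ∩ {z | Λ z ≤ (n : NNReal)}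
  have hTm : ∀ n, MeasurableSet (T n) := fun n =>
    (measurableSet_spanningSets μ n).inter (measurableSet_le hΛm measurable_const)
  have hTmono : Monotone T := by
    intro m n hmn z hz
    have h1 : Λ z ≤ (m : NNReal) := hz.2
    have h2 : Λ z ≤ (n : NNReal) := h1.trans (by exact_mod_cast hmn)
    exact ⟨monotone_spanningSets μ hmn hz.1, h2⟩
  have hTU : ∀ᵐ z ∂μ, z ∈ ⋃ n, T n := by
    filter_upwards [hfin] with z hz
    have h1 : z ∈ ⋃ n, spanningSets μ n := by rw [iUnion_spanningSets]; trivial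
    obtain ⟨n₁, h1⟩ := Set.mem_iUnion.mp h1
    obtain ⟨n₂, h2⟩ := ENNReal.exists_nat_gt hz
    have h3 : Λ z ≤ ((max n₁ n₂ : ℕ) : NNReal) :=
      h2.le.trans (by exact_mod_cast le_max_right n₁ n₂)
    exact Set.mem_iUnion.mpr ⟨max n₁ n₂, monotone_spanningSets μ (le_max_left _ _) h1, h3⟩
  have hlim : ∀ R : Measure (EuclideanSpace ℝ (Fin d) × ℝ), R ≪ μ →
      R S = ⨆ n, R (S ∩ T n) := by
    intro R hR
    rw [← (show Monotone fun n => S ∩ T n from fun m n hmn =>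
      Set.inter_subset_inter_right S (hTmono hmn)).measure_iUnion, ← Set.inter_iUnion]
    refine (measure_inter_conull' ?_).symm
    refine hR ?_
    refine measure_mono_null ?_ hTU
    exact fun z hz => hz.2
  have hMN : M S = N S := by
    rw [hlim M (Measure.absolutelyContinuous_of_le hMμ),
      hlim N (withDensity_absolutelyContinuous _ _)]
    refine iSup_congr fun n => ?_
    have hST := hS.inter (hTm n)
    rw [hM _ hST, withDensity_apply _ hST]
    refine lintegral_degree_eq_of_bounded h hφ hST ?_ (K := n) (fun z hz => hz.2.2) k
    refine ne_top_of_le_ne_top (measure_spanningSets_lt_top μ n).ne (measure_mono ?_)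
    exact fun z hz => hz.2.1
  rw [← hM S hS, hMN, withDensity_apply _ hS]

end

/-! ### Finite moments of the weights -/

theorem measure_Ioi_eq_ofReal (ν : Measure ℝ) [IsProbabilityMeasure ν] (x : ℝ) :
    ν (Set.Ioi x) = ENNReal.ofReal (1 - cdf ν x) := by
  rw [cdf_eq_real, ← probReal_compl_eq_one_sub measurableSet_Iic, Set.compl_Iic,
    ofReal_measureReal]

/-- Geometric decay of a regularly varying tail along dyadic sequences. -/
theorem RegularlyVaryingTail.exists_geometric_bound {f : ℝ → ℝ} {β c : ℝ}
    (hf : RegularlyVaryingTail f β) (hc : c < β) :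
    ∃ x₀ : ℝ, 0 < x₀ ∧ ∀ n : ℕ, f (2 ^ n * x₀) ≤ ((2 : ℝ) ^ (-c)) ^ n * f x₀ := by
  have h1 : (2 : ℝ) ^ (-β) < 2 ^ (-c) :=
    Real.rpow_lt_rpow_of_exponent_lt one_lt_two (neg_lt_neg hc)
  have h2 := (hf.2 2 two_pos).eventually_lt_const h1
  obtain ⟨x₁, hx₁⟩ := eventually_atTop.mp (h2.and hf.1)
  -- Starting beyond `x₁` and at a positive point keeps all dyadic multiples beyond `x₁`, so the
  -- one-step bound iterates.
  refine ⟨max x₁ 1, lt_of_lt_of_le one_pos (le_max_right _ _), fun n => ?_⟩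
  induction n with
  | zero => simp
  | succ n ih =>
    have h3 : x₁ ≤ 2 ^ n * max x₁ 1 := by
      have h4 : (1 : ℝ) ≤ 2 ^ n := one_le_pow₀ one_le_two
      have h5 : 0 ≤ max x₁ 1 := le_trans zero_le_one (le_max_right _ _)
      nlinarith [le_max_left x₁ 1]
    obtain ⟨h4, h5⟩ := hx₁ _ h3
    rw [div_lt_iff₀ h5] at h4
    rw [pow_succ', mul_assoc, pow_succ', mul_assoc]
    exact h4.le.trans (mul_le_mul_of_nonneg_left ih (by positivity))

/-- A law with a regularly varying tail of index `β` has finite moments of order below `β`. -/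
theorem integrable_rpow_of_regularlyVarying {ν : Measure ℝ} [IsProbabilityMeasure ν]
    (hpos : ∀ᵐ w ∂ν, 0 < w) {a β : ℝ} (ha : 0 ≤ a) (haβ : a < β)
    (hν : RegularlyVaryingTail (fun w => 1 - cdf ν w) β) : Integrable (fun u => u ^ a) ν := by
  -- An exponent strictly in between: `c < β` bounds the tail by a multiple of 2^(-cn), and `a < c`
  -- makes 2^((a-c)n) summable.
  obtain ⟨c, hac, hcβ⟩ := exists_between haβ
  obtain ⟨x, hx, hbound⟩ := hν.exists_geometric_bound hcβ
  have hmaj : ∀ u : ℝ, 0 < u → ENNReal.ofReal (u ^ a) ≤ ENNReal.ofReal ((2 * x) ^ a) +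
      ∑' n : ℕ, ENNReal.ofReal ((2 ^ (n + 2) * x) ^ a) *
        (Set.Ioi (2 ^ n * x)).indicator (fun _ => 1) u := by
    intro u hu
    rcases le_total u (2 * x) with hux | hux
    · exact (ENNReal.ofReal_le_ofReal (Real.rpow_le_rpow hu.le hux ha)).trans le_self_add
    · obtain ⟨n, hn1, hn2⟩ := exists_nat_pow_near ((one_le_div (by positivity)).mpr hux) one_lt_two
      rw [le_div_iff₀ (by positivity)] at hn1
      rw [div_lt_iff₀ (by positivity)] at hn2
      refine le_trans ?_ le_add_self
      refine le_trans ?_ (ENNReal.le_tsum n)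
      have h1 : u ∈ Set.Ioi (2 ^ n * x) := by
        have : 0 < (2 : ℝ) ^ n * x := by positivity
        rw [Set.mem_Ioi]
        linarith
      rw [Set.indicator_of_mem h1, mul_one]
      refine ENNReal.ofReal_le_ofReal (Real.rpow_le_rpow hu.le ?_ ha)
      calc u ≤ 2 ^ (n + 1) * (2 * x) := hn2.le
        _ = 2 ^ (n + 2) * x := by ring
  have hterm : ∀ n : ℕ, ENNReal.ofReal ((2 ^ (n + 2) * x) ^ a) * ν (Set.Ioi (2 ^ n * x)) ≤
      ENNReal.ofReal ((4 * x) ^ a * ((2 : ℝ) ^ (a - c)) ^ n) := by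
    intro n
    rw [measure_Ioi_eq_ofReal, ← ENNReal.ofReal_mul (by positivity)]
    refine ENNReal.ofReal_le_ofReal ?_
    have h1 : 1 - cdf ν (2 ^ n * x) ≤ ((2 : ℝ) ^ (-c)) ^ n := by
      refine (hbound n).trans (mul_le_of_le_one_right (by positivity) ?_)
      linarith [cdf_nonneg ν x]
    have h2 : ((2 : ℝ) ^ (n + 2) * x) ^ a = (4 * x) ^ a * ((2 : ℝ) ^ a) ^ n := by
      rw [show (2 : ℝ) ^ (n + 2) * x = (4 * x) * 2 ^ n by ring,
        Real.mul_rpow (by positivity) (by positivity), ← Real.rpow_natCast, ← Real.rpow_natCast,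
        ← Real.rpow_mul two_pos.le, ← Real.rpow_mul two_pos.le, mul_comm a]
    rw [h2, sub_eq_add_neg a c, Real.rpow_add two_pos, mul_pow, mul_assoc]
    gcongr
  have hfin : ∫⁻ u, ENNReal.ofReal (u ^ a) ∂ν < ⊤ := by
    have h1 : ∫⁻ u, ENNReal.ofReal (u ^ a) ∂ν ≤ ∫⁻ u, (ENNReal.ofReal ((2 * x) ^ a) +
      ∑' n : ℕ, ENNReal.ofReal ((2 ^ (n + 2) * x) ^ a) *
        (Set.Ioi (2 ^ n * x)).indicator (fun _ => 1) u) ∂ν := by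
      refine lintegral_mono_ae ?_
      filter_upwards [hpos] with u hu using hmaj u hu
    refine h1.trans_lt ?_
    rw [lintegral_add_left measurable_const, lintegral_const, measure_univ, mul_one, lintegral_tsum]
    · have h2 : ∀ n : ℕ, ∫⁻ u, ENNReal.ofReal ((2 ^ (n + 2) * x) ^ a) *
          (Set.Ioi (2 ^ n * x)).indicator (fun _ => 1) u ∂ν =
          ENNReal.ofReal ((2 ^ (n + 2) * x) ^ a) * ν (Set.Ioi (2 ^ n * x)) := by
        intro n
        rw [lintegral_const_mul _ (measurable_const.indicator measurableSet_Ioi)]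
        exact congrArg _ (lintegral_indicator_one measurableSet_Ioi)
      simp_rw [h2]
      refine ENNReal.add_lt_top.mpr ⟨ENNReal.ofReal_lt_top, ?_⟩
      refine (ENNReal.tsum_le_tsum hterm).trans_lt ?_
      have h3 : Summable fun n : ℕ => (4 * x) ^ a * ((2 : ℝ) ^ (a - c)) ^ n := by
        refine (summable_geometric_of_lt_one (by positivity) ?_).mul_left _
        exact Real.rpow_lt_one_of_one_lt_of_neg one_lt_two (by linarith)
      rw [← ENNReal.ofReal_tsum_of_nonneg (fun n => by positivity) h3]
      exact ENNReal.ofReal_lt_top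
    · exact fun n => ((measurable_const.indicator measurableSet_Ioi).const_mul _).aemeasurable
  refine ⟨by fun_prop, ?_⟩
  rw [hasFiniteIntegral_iff_ofReal]
  · exact hfin
  · filter_upwards [hpos] with u hu
    positivity

/-! ### Computing the mean degree -/

/-- The volume of the centered ball reaching to a point has law Lebesgue measure on `(0, ∞)`. -/
theorem map_volume_ball_dist {d : ℕ} (hd : 1 ≤ d) (x : EuclideanSpace ℝ (Fin d)) :
    (volume : Measure (EuclideanSpace ℝ (Fin d))).map
      (fun y => volume.real (Metric.ball (0 : EuclideanSpace ℝ (Fin d)) (dist x y))) =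
      (volume : Measure ℝ).restrict (Set.Ioi 0) := by
  have : Nonempty (Fin d) := ⟨⟨0, hd⟩⟩
  have hm : Measurable fun y : EuclideanSpace ℝ (Fin d) =>
      volume.real (Metric.ball (0 : EuclideanSpace ℝ (Fin d)) (dist x y)) :=
    (measurable_volume_real_ball d).comp (by fun_prop)
  set V := volume.real (Metric.ball (0 : EuclideanSpace ℝ (Fin d)) 1) with hV
  have hVpos : 0 < V :=
    ENNReal.toReal_pos (Metric.measure_ball_pos _ _ one_pos).ne' measure_ball_lt_top.ne
  have hball : ∀ (z : EuclideanSpace ℝ (Fin d)) (r : ℝ), 0 ≤ r →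
      volume (Metric.ball z r) = ENNReal.ofReal (r ^ d * V) := by
    intro z r hr
    rw [Measure.addHaar_ball _ _ hr, finrank_euclideanSpace_fin, ENNReal.ofReal_mul (by positivity),
      hV, ofReal_measureReal]
  have hreal : ∀ y, volume.real (Metric.ball (0 : EuclideanSpace ℝ (Fin d)) (dist x y)) =
      dist x y ^ d * V := by
    intro y
    rw [Measure.real, hball _ _ dist_nonneg, ENNReal.toReal_ofReal (by positivity)]
  have hIio : ∀ t : ℝ, (volume : Measure (EuclideanSpace ℝ (Fin d))).map
      (fun y => volume.real (Metric.ball (0 : EuclideanSpace ℝ (Fin d)) (dist x y))) (Set.Iio t) =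
      ENNReal.ofReal t := by
    intro t
    rw [Measure.map_apply hm measurableSet_Iio]
    rcases le_or_gt t 0 with ht | ht
    · rw [ENNReal.ofReal_of_nonpos ht]
      convert measure_empty (μ := (volume : Measure (EuclideanSpace ℝ (Fin d))))
      refine Set.eq_empty_of_forall_notMem fun y hy => ?_
      exact absurd (lt_of_lt_of_le hy ht) (not_lt.mpr measureReal_nonneg)
    -- The sublevel set is the ball about `x` whose volume is exactly `t`.
    · have h1 : (fun y => volume.real (Metric.ball (0 : EuclideanSpace ℝ (Fin d)) (dist x y))) ⁻¹'
          Set.Iio t = Metric.ball x ((t / V) ^ ((d : ℝ)⁻¹)) := by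
        ext y
        have h2 : dist x y ^ d * V < t ↔ dist x y ^ d < t / V := (lt_div_iff₀ hVpos).symm
        rw [Set.mem_preimage, Set.mem_Iio, hreal, h2, Metric.mem_ball, dist_comm y x,
          ← Real.rpow_natCast]
        exact (Real.lt_rpow_inv_iff_of_pos dist_nonneg (by positivity)
          (by exact_mod_cast hd)).symm
      rw [h1, hball _ _ (by positivity), Real.rpow_inv_natCast_pow (by positivity) (by omega),
        div_mul_cancel₀ _ hVpos.ne']
  refine Measure.ext_of_generateFrom_of_iUnion (Set.range Set.Iio) (fun n : ℕ => Set.Iio (n : ℝ))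
    (borel_eq_generateFrom_Iio ℝ ▸ BorelSpace.measurable_eq) isPiSystem_Iio ?_
    (fun n => ⟨n, rfl⟩) (fun n => by rw [hIio]; exact ENNReal.ofReal_ne_top) ?_
  · refine Set.eq_univ_of_forall fun t => Set.mem_iUnion.mpr ?_
    exact exists_nat_gt t
  · rintro _ ⟨t, rfl⟩
    rw [hIio, Measure.restrict_apply measurableSet_Iio, Set.Iio_inter_Ioi, Real.volume_Ioo, sub_zero]

theorem lintegral_comp_volume_ball {d : ℕ} (hd : 1 ≤ d) (x : EuclideanSpace ℝ (Fin d))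
    {f : ℝ → ENNReal} (hf : Measurable f) :
    ∫⁻ y, f (volume.real (Metric.ball (0 : EuclideanSpace ℝ (Fin d)) (dist x y))) =
      ∫⁻ r in Set.Ioi (0 : ℝ), f r := by
  have hm : Measurable fun y : EuclideanSpace ℝ (Fin d) =>
      volume.real (Metric.ball (0 : EuclideanSpace ℝ (Fin d)) (dist x y)) :=
    (measurable_volume_real_ball d).comp (by fun_prop)
  rw [← map_volume_ball_dist hd x, lintegral_map hf hm]

theorem lintegral_profile {φ : ℝ → ℝ} (hφ_mem : ∀ r, 0 ≤ r → φ r ∈ Set.Icc (0 : ℝ) 1)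
    (hφ_int : ∫ r in Set.Ioi (0 : ℝ), φ r = 1) {c : ℝ} (hc : 0 < c) :
    ∫⁻ r in Set.Ioi (0 : ℝ), unifBelow (φ (r / c)) = ENNReal.ofReal c := by
  have h1 : ∫ r in Set.Ioi (0 : ℝ), φ (r / c) = c := by
    have h2 := integral_comp_mul_left_Ioi φ 0 (inv_pos.mpr hc)
    rw [mul_zero, hφ_int, inv_inv, smul_eq_mul, mul_one] at h2
    simpa only [div_eq_inv_mul] using h2
  -- The Bochner integral of a non-integrable function is 0, so a nonzero value certifies
  -- integrability.
  have hint : Integrable (fun r => φ (r / c)) (volume.restrict (Set.Ioi 0)) :=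
    Integrable.of_integral_ne_zero (by rw [h1]; exact hc.ne')
  have h3 : ∫⁻ r in Set.Ioi (0 : ℝ), unifBelow (φ (r / c)) =
      ∫⁻ r in Set.Ioi (0 : ℝ), ENNReal.ofReal (φ (r / c)) :=
    setLIntegral_congr_fun measurableSet_Ioi fun r hr =>
      unifBelow_eq_ofReal (hφ_mem _ (div_nonneg (le_of_lt hr) hc.le))
  rw [h3, ← ofReal_integral_eq_lintegral_ofReal hint, h1]
  filter_upwards [ae_restrict_mem measurableSet_Ioi] with r hr
  exact (hφ_mem _ (div_nonneg (le_of_lt hr) hc.le)).1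

theorem kernel_pos {a w u : ℝ} (hw : 0 < w) (hu : 0 < u) : 0 < kernel a w u :=
  mul_pos (lt_min hw hu) (Real.rpow_pos_of_pos (lt_max_of_lt_left hw) _)

theorem measurable_kernel (a w : ℝ) : Measurable (kernel a w) := by
  unfold kernel
  fun_prop

theorem setIntegral_rpow_nonneg {ν : Measure ℝ} (hpos : ∀ᵐ w ∂ν, 0 < w) (a : ℝ) (S : Set ℝ) :
    0 ≤ ∫ u in S, u ^ a ∂ν := by
  refine integral_nonneg_of_ae ?_
  filter_upwards [ae_restrict_of_ae hpos] with u hu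
  exact Real.rpow_nonneg hu.le _

theorem setIntegral_id_nonneg {ν : Measure ℝ} (hpos : ∀ᵐ w ∂ν, 0 < w) (S : Set ℝ) :
    0 ≤ ∫ u in S, u ∂ν := by
  refine integral_nonneg_of_ae ?_
  filter_upwards [ae_restrict_of_ae hpos] with u hu
  exact hu.le

theorem h_nonneg {ν : Measure ℝ} (hpos : ∀ᵐ w ∂ν, 0 < w) {a w : ℝ} (hw : 0 < w) :
    0 ≤ h a ν w :=
  add_nonneg (mul_nonneg hw.le (setIntegral_rpow_nonneg hpos _ _))
    (mul_nonneg (Real.rpow_nonneg hw.le _) (setIntegral_id_nonneg hpos _))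

theorem lintegral_kernel {ν : Measure ℝ} [IsProbabilityMeasure ν] (hpos : ∀ᵐ w ∂ν, 0 < w) {a : ℝ}
    (hint : Integrable (fun u => u ^ a) ν) {w : ℝ} (hw : 0 < w) :
    ∫⁻ u, ENNReal.ofReal (kernel a w u) ∂ν = ENNReal.ofReal (h a ν w) := by
  -- On `(0, w)` the identity is bounded by `w`, so no first moment of the weight is needed.
  have hIio : IntegrableOn (fun u : ℝ => u) (Set.Iio w) ν := by
    refine Measure.integrableOn_of_bounded (measure_ne_top _ _) (by fun_prop) (M := w) ?_
    filter_upwards [ae_restrict_mem measurableSet_Iio, ae_restrict_of_ae hpos] with u hu hu'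
    rw [Real.norm_of_nonneg hu'.le]
    exact le_of_lt hu
  have h1 : ∫⁻ u in Set.Ici w, ENNReal.ofReal (kernel a w u) ∂ν =
      ENNReal.ofReal (w * ∫ u in Set.Ici w, u ^ a ∂ν) := by
    rw [← integral_const_mul, ofReal_integral_eq_lintegral_ofReal (hint.integrableOn.const_mul w)]
    · refine setLIntegral_congr_fun measurableSet_Ici fun u hu => ?_
      simp only [kernel, min_eq_left (Set.mem_Ici.mp hu), max_eq_right (Set.mem_Ici.mp hu)]
    · filter_upwards [ae_restrict_of_ae hpos] with u hu
      exact mul_nonneg hw.le (Real.rpow_nonneg hu.le _)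
  have h2 : ∫⁻ u in Set.Iio w, ENNReal.ofReal (kernel a w u) ∂ν =
      ENNReal.ofReal (w ^ a * ∫ u in Set.Iio w, u ∂ν) := by
    rw [← integral_const_mul, ofReal_integral_eq_lintegral_ofReal (hIio.const_mul _)]
    · refine setLIntegral_congr_fun measurableSet_Iio fun u hu => ?_
      simp only [kernel, min_eq_right (le_of_lt (Set.mem_Iio.mp hu)),
        max_eq_left (le_of_lt (Set.mem_Iio.mp hu)), mul_comm]
    · filter_upwards [ae_restrict_of_ae hpos] with u hu
      exact mul_nonneg (Real.rpow_nonneg hw.le _) hu.le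
  rw [← lintegral_add_compl _ (measurableSet_Ici (a := w)), Set.compl_Ici, h1, h2, h,
    ENNReal.ofReal_add]
  · exact mul_nonneg hw.le (setIntegral_rpow_nonneg hpos _ _)
  · exact mul_nonneg (Real.rpow_nonneg hw.le _) (setIntegral_id_nonneg hpos _)

/-- For a fixed neighbor weight, the spatial integral of the profile scaled by v κ is v κ, since the
profile has integral 1. Averaging κ over the weight produces `h`. -/
theorem meanDegree_eq {d : ℕ} (hd : 1 ≤ d) {φ : ℝ → ℝ} (hφ : Measurable φ)
    (hφ_mem : ∀ r, 0 ≤ r → φ r ∈ Set.Icc (0 : ℝ) 1) (hφ_int : ∫ r in Set.Ioi (0 : ℝ), φ r = 1)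
    {ν : Measure ℝ} [IsProbabilityMeasure ν] (hpos : ∀ᵐ w ∂ν, 0 < w) {a v s : ℝ}
    (hint : Integrable (fun u => u ^ a) ν) (hv : 0 < v) (hs : 0 < s)
    {z : EuclideanSpace ℝ (Fin d) × ℝ} (hz : 0 < z.2) :
    meanDegree a φ v d s ν z = ENNReal.ofReal (s * v * h a ν z.2) := by
  have hz' : Measurable fun z' : EuclideanSpace ℝ (Fin d) × ℝ => (z, z') := measurable_prodMk_left
  have hc := (measurable_connProb (d := d) (a := a) (v := v) hφ).comp hz'
  have hm : Measurable fun z' : EuclideanSpace ℝ (Fin d) × ℝ =>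
      unifBelow (connProb d a φ v z.1 z.2 z'.1 z'.2) := measurable_unifBelow.comp hc
  have h1 : ∀ u : ℝ, 0 < u → ∫⁻ y, unifBelow (connProb d a φ v z.1 z.2 y u)
      ∂(ENNReal.ofReal s • (volume : Measure (EuclideanSpace ℝ (Fin d)))) =
      ENNReal.ofReal (s * v) * ENNReal.ofReal (kernel a z.2 u) := by
    intro u hu
    have hκ := kernel_pos (a := a) hz hu
    have hf : Measurable fun r => unifBelow (φ (r / (v * kernel a z.2 u))) :=
      measurable_unifBelow.comp (hφ.comp (measurable_id.div_const _))
    have h2 := lintegral_comp_volume_ball hd z.1 hf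
    rw [lintegral_profile hφ_mem hφ_int (mul_pos hv hκ)] at h2
    simp only [connProb]
    rw [lintegral_smul_measure, smul_eq_mul, h2, ENNReal.ofReal_mul hv.le, ENNReal.ofReal_mul hs.le,
      mul_assoc]
  rw [meanDegree, markedIntensity, lintegral_prod_symm _ hm.aemeasurable]
  have h4 : ∀ᵐ u ∂ν, ∫⁻ y, unifBelow (connProb d a φ v z.1 z.2 y u)
      ∂(ENNReal.ofReal s • (volume : Measure (EuclideanSpace ℝ (Fin d)))) =
      ENNReal.ofReal (s * v) * ENNReal.ofReal (kernel a z.2 u) := by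
    filter_upwards [hpos] with u hu using h1 u hu
  rw [lintegral_congr_ae h4, lintegral_const_mul _ (measurable_kernel _ _).ennreal_ofReal,
    lintegral_kernel hpos hint hz, ← ENNReal.ofReal_mul (by positivity)]

theorem volume_unitCube (d : ℕ) :
    volume {x : EuclideanSpace ℝ (Fin d) | ∀ l, x l ∈ Set.Icc (0 : ℝ) 1} = 1 := by
  have h1 : {x : EuclideanSpace ℝ (Fin d) | ∀ l, x l ∈ Set.Icc (0 : ℝ) 1} =
      (WithLp.ofLp) ⁻¹' (Set.univ.pi fun _ : Fin d => Set.Icc (0 : ℝ) 1) := by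
    ext x
    simp only [Set.mem_preimage, Set.mem_univ_pi, Set.mem_ofPred_eq]
  rw [h1, (PiLp.volume_preserving_ofLp (Fin d)).measure_preimage
    (MeasurableSet.univ_pi fun _ => measurableSet_Icc).nullMeasurableSet, volume_pi_pi]
  simp

theorem measurableSet_unitCube (d : ℕ) :
    MeasurableSet {x : EuclideanSpace ℝ (Fin d) | ∀ l, x l ∈ Set.Icc (0 : ℝ) 1} := by
  simp only [Set.ofPred_forall]
  exact MeasurableSet.iInter fun l => (by fun_prop :
    Measurable fun x : EuclideanSpace ℝ (Fin d) => x l) measurableSet_Icc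

/-! ### The scaling equation and the conclusion -/

theorem lintegral_poisson_scaling {ν : Measure ℝ} {a s v : ℝ} {k : ℕ} (hs : 0 < s)
    (hν : ∀ᵐ w ∂ν, 0 ≤ s * v * h a ν w) (hv : IsScaling a ν s k v) :
    ENNReal.ofReal s * ∫⁻ w, poissonMeasure (ENNReal.ofReal (s * v * h a ν w)).toNNReal {k} ∂ν =
      1 := by
  have hk : (k.factorial : ℝ) ≠ 0 := by positivity
  obtain ⟨-, h1⟩ := hv.1
  -- The integral cannot take the default value 0, because multiplied by `s` it equals k!, which is
  -- nonzero.
  have hint : Integrable (fun w => (s * v * h a ν w) ^ k * Real.exp (-(s * v * h a ν w))) ν := by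
    refine Integrable.of_integral_ne_zero fun h0 => ?_
    rw [h0, mul_zero] at h1
    exact hk h1
  have h2 : ∫⁻ w, poissonMeasure (ENNReal.ofReal (s * v * h a ν w)).toNNReal {k} ∂ν =
      ∫⁻ w, ENNReal.ofReal
        ((s * v * h a ν w) ^ k * Real.exp (-(s * v * h a ν w)) / k.factorial) ∂ν := by
    refine lintegral_congr_ae ?_
    filter_upwards [hν] with w hw
    rw [poissonMeasure_singleton, ← ENNReal.coe_toReal, ENNReal.coe_toNNReal
      ENNReal.ofReal_ne_top, ENNReal.toReal_ofReal hw, mul_comm (Real.exp _)]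
  have h3 : 0 ≤ᵐ[ν] fun w =>
      (s * v * h a ν w) ^ k * Real.exp (-(s * v * h a ν w)) / k.factorial := by
    filter_upwards [hν] with w hw
    positivity
  rw [h2, ← ofReal_integral_eq_lintegral_ofReal (hint.div_const _) h3, integral_div,
    ← ENNReal.ofReal_mul hs.le, ← mul_div_assoc, ← h1, div_self hk, ENNReal.ofReal_one]

end WRCM

theorem lemma2p1
    -- dimension, kernel parameter and tail indices
    (d : ℕ) (hd : 1 ≤ d) (a α β : ℝ) (ha : 0 ≤ a) (hα : 1 < α) (hβ : a * α < β)
    -- profile function, with values only relevant on `[0, ∞)`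
    (φ : ℝ → ℝ) (hφ_meas : Measurable φ) (hφ_mem : ∀ r, 0 ≤ r → φ r ∈ Set.Icc (0 : ℝ) 1)
    (hφ_int : ∫ r in Set.Ioi (0 : ℝ), φ r = 1) (hφ_rv : WRCM.RegularlyVaryingTail φ α)
    -- weight distribution on `(0, ∞)`
    (ν : Measure ℝ) [IsProbabilityMeasure ν] (hν_pos : ∀ᵐ w ∂ν, 0 < w)
    (hν_rv : WRCM.RegularlyVaryingTail (fun w => 1 - cdf ν w) β)
    -- intensity, degree and scaling `v = v_{s,k}`
    (s : ℝ) (hs : 0 < s) (k : ℕ) (v : ℝ) (hv : WRCM.IsScaling a ν s k v)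
    -- the random graph
    {Ω : Type*} [MeasurableSpace Ω] (P : Measure Ω) [IsProbabilityMeasure P]
    (X : ℕ → Ω → EuclideanSpace ℝ (Fin d)) (W : ℕ → Ω → ℝ) (U : Sym2 ℕ → Ω → ℝ)
    (hmodel : WRCM.IsModelInput P s ν X W U) :
    Measurable (WRCM.degreeCount a φ v k X W U) ∧
      ∫⁻ ω, (WRCM.degreeCount a φ v k X W U ω : ENNReal) ∂P = 1 := by
  have hvpos : 0 < v := hv.1.1
  have haβ : a < β := lt_of_le_of_lt (le_mul_of_one_le_right ha hα.le) hβ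
  have hint := WRCM.integrable_rpow_of_regularlyVarying hν_pos ha haβ hν_rv
  set A := {x : EuclideanSpace ℝ (Fin d) | ∀ l, x l ∈ Set.Icc (0 : ℝ) 1} with hA
  have hAm : MeasurableSet A := WRCM.measurableSet_unitCube d
  have hdeg := WRCM.measurable_degree (a := a) (v := v) hφ_meas hmodel.ppp.measurable
    hmodel.weight_measurable hmodel.unif_measurable
  refine ⟨?_, ?_⟩
  · refine measurable_encard.comp ?_
    rw [measurable_set_iff]
    intro i
    refine (measurableSet_setOfPred (p := fun ω => (∀ l, X i ω l ∈ Set.Icc (0 : ℝ) 1) ∧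
      ((WRCM.graph a φ v X W U ω).neighborSet i).encard = k)).mp ?_
    exact (hmodel.ppp.measurable i hAm).inter (hdeg i (measurableSet_singleton (k : ℕ∞)))
  have hmean : ∀ z : EuclideanSpace ℝ (Fin d) × ℝ, 0 < z.2 →
      WRCM.meanDegree a φ v d s ν z = ENNReal.ofReal (s * v * WRCM.h a ν z.2) := fun z hz =>
    WRCM.meanDegree_eq hd hφ_meas hφ_mem hφ_int hν_pos hint hvpos hs hz
  have hzpos : ∀ᵐ z ∂(WRCM.markedIntensity d s ν), 0 < z.2 :=
    Measure.quasiMeasurePreserving_snd.ae hν_pos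
  have hfin : ∀ᵐ z ∂(WRCM.markedIntensity d s ν), WRCM.meanDegree a φ v d s ν z ≠ ⊤ := by
    filter_upwards [hzpos] with z hz
    rw [hmean z hz]
    exact ENNReal.ofReal_ne_top
  have hcount : ∀ ω, (WRCM.degreeCount a φ v k X W U ω : ENNReal) =
      ∑' i, (A ×ˢ Set.univ).indicator (fun _ => (1 : ENNReal)) (X i ω, W i ω) *
        (if ((WRCM.graph a φ v X W U ω).neighborSet i).encard = k then 1 else 0) := by
    intro ω
    rw [WRCM.degreeCount, ← ENNReal.tsum_set_one]
    refine (tsum_subtype _ fun _ => (1 : ENNReal)).trans ?_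
    refine tsum_congr fun i => ?_
    by_cases h1 : X i ω ∈ A <;>
      by_cases h2 : ((WRCM.graph a φ v X W U ω).neighborSet i).encard = k <;>
      simp_all [Set.indicator]
  have hh : ∀ᵐ w ∂ν, 0 ≤ s * v * WRCM.h a ν w := by
    filter_upwards [hν_pos] with w hw
    exact mul_nonneg (by positivity) (WRCM.h_nonneg hν_pos hw)
  simp_rw [hcount]
  rw [WRCM.lintegral_degree_eq hmodel hφ_meas hfin (hAm.prod .univ) k]
  have h1 : ∫⁻ z in A ×ˢ Set.univ, poissonMeasure (WRCM.meanDegree a φ v d s ν z).toNNReal {k}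
      ∂(WRCM.markedIntensity d s ν) =
      ∫⁻ z in A ×ˢ Set.univ, poissonMeasure
        (ENNReal.ofReal (s * v * WRCM.h a ν z.2)).toNNReal {k} ∂(WRCM.markedIntensity d s ν) := by
    refine lintegral_congr_ae (ae_restrict_of_ae ?_)
    filter_upwards [hzpos] with z hz
    rw [hmean z hz]
  -- Measurability is inherited from `meanDegree`, which agrees almost everywhere with s v h; the
  -- position 0 is arbitrary, as the mean degree depends only on the weight there.
  have hm : AEMeasurable (fun w => poissonMeasure
      (ENNReal.ofReal (s * v * WRCM.h a ν w)).toNNReal {k}) ν := by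
    have hz : Measurable fun w : ℝ => ((0 : EuclideanSpace ℝ (Fin d)), w) := measurable_prodMk_left
    have hΛ := (WRCM.measurable_poisson_toNNReal k).comp
      ((WRCM.measurable_meanDegree (d := d) (s := s) (ν := ν) (a := a) (v := v) hφ_meas).comp hz)
    refine hΛ.aemeasurable.congr ?_
    filter_upwards [hν_pos] with w hw
    exact congrArg (fun x => poissonMeasure (ENNReal.toNNReal x) {k}) (hmean (0, w) hw)
  rw [h1, WRCM.markedIntensity, ← Measure.prod_restrict, Measure.restrict_univ,
    lintegral_prod_symm _ hm.comp_snd]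
  simp only [lintegral_const, Measure.restrict_apply_univ, Measure.smul_apply, smul_eq_mul,
    hA, WRCM.volume_unitCube, mul_one]
  rw [lintegral_mul_const' _ _ ENNReal.ofReal_ne_top, mul_comm]
  exact WRCM.lintegral_poisson_scaling hs hh hv
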